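/- \textbf{Sharpness of Thomsen's bounds.} Let $Z$ be a nonempty compact Hausdorff space and $h:Z\to Z$ a surjective local homeomorphism. Let $X=C(Z)$ be the Hilbert bimodule over $C(Z)$ with $$(a\cdot x\cdot b)(z)=a(z)x(z)b(h(z)),\qquad \langle x,y\rangle(z)=\sum_{h(w)=z}\overline{x(w)}\,y(w),$$ let $\mathcal O(X)$ be its Cuntz--Pimsner algebra (the $C^*$-algebra generated by the universal Cuntz--Pimsner covariant representation $(\psi,\pi)$ of $X$), and let $\alpha_t=\gamma_{e^{it}}$, where $\gamma$ is the gauge action of the circle, given by $\gamma_c(\psi(x))=c\,\psi(x)$ and $\gamma_c(\pi(a))=\pi(a)$. A state $\phi$ is a KMS$_\beta$ state if $\phi(ab)=\phi(b\,\alpha_{i\beta}(a))$ for all $b$ and all $\alpha$-analytic $a$. Put $$\beta_c=\limsup_{n\to\infty}\frac1n\ln\Big(\max_{z\in Z}|h^{-n}(z)|\Big),\qquad \beta_l=\limsup_{n\to\infty}\frac1n\ln\Big(\min_{z\in Z}|h^{-n}(z)|\Big).$$ (1) If $(\mathcal O(X),\alpha)$ has a KMS$_\beta$ state, then $\beta_l\le\beta\le\beta_c$;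 and the upper bound is always attained: $(\mathcal O(X),\alpha)$ has a KMS$_{\beta_c}$ state. (2) Let $E$ be the dumbbell graph with two vertices $v,w$, two loops at $v$, three loops at $w$, and one edge with source $w$ and range $v$. Let $E^\infty$ be its infinite-path space, consisting of the sequences $e_1e_2\cdots$ of edges with $s(e_i)=r(e_{i+1})$, with the topology inherited from the product of the discrete spaces $E^1$, and let $\sigma(e_1e_2e_3\cdots)=e_2e_3\cdots$ be the shift, a local homeomorphism of $E^\infty$. Then $\min_{x\in E^\infty}|\sigma^{-n}(x)|=2^n$ for all $n\ge 0$; Thomsen's bounds for $\sigma$ are $\beta_l=\ln 2$ and $\beta_c=\ln 3$; and both are attained: $\ln 2$ is the least and $\ln 3$ the greatest inverse temperature of a KMS state of $(\mathcal O(X(E^\infty)),\alpha)$, where $X(E^\infty)$ is the bimodule $X$ above for $Z=E^\infty$ and $h=\sigma$. -/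

import Mathlib

open Filter Topology
open scoped ENNReal ComplexOrder ComplexConjugate

/-! ### KMS states -/

section KMS

variable {A : Type*} [CStarAlgebra A]

/-- A state of a unital C*-algebra: a positive linear functional `φ` with `φ 1 = 1`. -/
structure IsState (φ : A →ₗ[ℂ] ℂ) : Prop where
  map_one : φ 1 = 1
  nonneg : ∀ a : A, 0 ≤ φ (star a * a)

/-- `φ` is a KMS state at inverse temperature `β` for the dynamics `α`: it is a state, and
`φ (a * b) = φ (b * α_{iβ}(a))` for all `b` and all analytic `a`.  An element `a` is analytic if
`t ↦ α_t(a)` extends to an entire function `F : ℂ → A`; the extension is unique, and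
`α_{iβ}(a)` is `F (iβ)`. -/
def IsKMSState (α : ℝ → (A ≃⋆ₐ[ℂ] A)) (β : ℝ) (φ : A →ₗ[ℂ] ℂ) : Prop :=
  IsState φ ∧ ∀ (a b : A) (F : ℂ → A), Differentiable ℂ F → (∀ t : ℝ, F (t : ℂ) = α t a) →
    φ (a * b) = φ (b * F (Complex.I * (β : ℂ)))

end KMS

/-! ### The Hilbert bimodule of a local homeomorphism of a compact Hausdorff space -/

section Bimodule

variable {Z : Type*} [TopologicalSpace Z] [CompactSpace Z] [T2Space Z] {h : Z → Z}

theorem IsLocalHomeomorph.finite_fiber (hh : IsLocalHomeomorph h) (z : Z) :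
    (h ⁻¹' {z}).Finite := by
  have hc : IsCoveringMap h := isLocalHomeomorph_iff_isCoveringMap.1 hh
  have := (hc z).discreteTopology_fiber
  exact (isClosed_singleton.preimage hh.continuous).isCompact.finite
    (isDiscrete_iff_discreteTopology.2 this)

theorem IsLocalHomeomorph.continuous_fiberSum (hh : IsLocalHomeomorph h) (f : C(Z, ℂ)) :
    Continuous fun z => ∑ᶠ w : h ⁻¹' {z}, f w := by
  have hc : IsCoveringMap h := isLocalHomeomorph_iff_isCoveringMap.1 hh
  rw [continuous_iff_continuousAt]
  intro z₀
  obtain ⟨_, U, hzU, hU, -, H, hH⟩ := hc z₀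
  have := Set.finite_coe_iff.2 (hh.finite_fiber z₀)
  have := Fintype.ofFinite (h ⁻¹' {z₀})
  rw [← continuousWithinAt_iff_continuousAt (hU.mem_nhds hzU)]
  suffices hs : ContinuousOn (fun z => ∑ᶠ w : h ⁻¹' {z}, f w) U from hs z₀ hzU
  rw [continuousOn_iff_continuous_domRestrict]
  have key : U.domRestrict (fun z => ∑ᶠ w : h ⁻¹' {z}, f w) =
      fun u : U => ∑ i : h ⁻¹' {z₀}, f (H.symm (u, i)) := by
    funext u
    have hp : ∀ p : U × (h ⁻¹' {z₀}), h (H.symm p) = p.1 := fun p => by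
      rw [← hH, Homeomorph.apply_symm_apply]
    let e : (h ⁻¹' {z₀}) ≃ (h ⁻¹' {(u : Z)}) :=
      { toFun := fun i => ⟨H.symm (u, i), hp (u, i)⟩
        invFun := fun w => (H ⟨w, by
          have hw : h w = u := w.2
          simp [hw]⟩).2
        left_inv := fun i => by simp
        right_inv := fun w => by
          have hw : h w = u := w.2
          have hwU : (w : Z) ∈ h ⁻¹' U := by simp [hw]
          have h1 : (H ⟨w, hwU⟩).1 = u := Subtype.ext ((hH _).trans hw)
          apply Subtype.ext
          have h2 : ((u, (H ⟨w, hwU⟩).2) : U × (h ⁻¹' {z₀})) = H ⟨w, hwU⟩ := by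
            exact Prod.ext h1.symm rfl
          change ((H.symm (u, (H ⟨w, hwU⟩).2) : h ⁻¹' U) : Z) = w
          rw [h2, Homeomorph.symm_apply_apply] }
    change ∑ᶠ w : h ⁻¹' {(u : Z)}, f w = _
    rw [← finsum_comp_equiv e, finsum_eq_sum_of_fintype]
    rfl
  rw [key]
  fun_prop

/-- The function `z ↦ ∑_{h(w) = z} f(w)`. -/
noncomputable def fiberSum (hh : IsLocalHomeomorph h) (f : C(Z, ℂ)) : C(Z, ℂ) :=
  ⟨fun z => ∑ᶠ w : h ⁻¹' {z}, f w, hh.continuous_fiberSum f⟩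

/-- The `C(Z)`-valued inner product `⟨x, y⟩(z) = ∑_{h(w) = z} conj (x w) * y w` on `X = C(Z)`. -/
noncomputable def bimoduleInner (hh : IsLocalHomeomorph h) (x y : C(Z, ℂ)) : C(Z, ℂ) :=
  fiberSum hh (star x * y)

/-- The right action `(x · b)(z) = x(z) b(h(z))` of `b ∈ C(Z)` on `x ∈ X = C(Z)`.  The left action
is the pointwise product `a * x`. -/
noncomputable def bimoduleRight (hh : IsLocalHomeomorph h) (x b : C(Z, ℂ)) : C(Z, ℂ) :=
  x * b.comp ⟨h, hh.continuous⟩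

/-- The rank-one operator `θ_{x,y} : w ↦ x · ⟨y, w⟩` on `X`. -/
noncomputable def rankOne (hh : IsLocalHomeomorph h) (x y w : C(Z, ℂ)) : C(Z, ℂ) :=
  bimoduleRight hh x (bimoduleInner hh y w)

end Bimodule


/-! ### Representations and the Cuntz-Pimsner algebra -/

section CuntzPimsner

universe u

variable {Z : Type u} [TopologicalSpace Z] [CompactSpace Z] [T2Space Z] {h : Z → Z}

/-- A Cuntz-Pimsner covariant representation `(ψ, π)` of the Hilbert bimodule `X = C(Z)` in a
nonzero unital C*-algebra.  The module `X` is finitely generated and projective, so every compact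
operator on it is a finite sum of rank-one operators `θ_{x,y}`, and the left action is by such
operators.  The field `covariant` is thus Pimsner's condition `(ψ, π)⁽¹⁾(φ(a)) = π(a)`, where
`(ψ, π)⁽¹⁾(θ_{x,y}) = ψ(x) ψ(y)*` and `φ(a)` is left multiplication by `a`. -/
structure CovariantRep (hh : IsLocalHomeomorph h) where
  alg : Type u
  [cstar : CStarAlgebra alg]
  [nontriv : Nontrivial alg]
  π : C(Z, ℂ) →⋆ₐ[ℂ] alg
  ψ : C(Z, ℂ) →ₗ[ℂ] alg
  left : ∀ a x, ψ (a * x) = π a * ψ x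
  right : ∀ x b, ψ (bimoduleRight hh x b) = ψ x * π b
  inner : ∀ x y, π (bimoduleInner hh x y) = star (ψ x) * ψ y
  covariant : ∀ (a : C(Z, ℂ)) (n : ℕ) (x y : Fin n → C(Z, ℂ)),
    (∀ w, a * w = ∑ i, rankOne hh (x i) (y i) w) → π a = ∑ i, ψ (x i) * star (ψ (y i))

attribute [instance] CovariantRep.cstar CovariantRep.nontriv

namespace CovariantRep

variable {hh : IsLocalHomeomorph h}

theorem norm_π_le (R : CovariantRep hh) (a : C(Z, ℂ)) : ‖R.π a‖ ≤ ‖a‖ :=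
  NonUnitalStarAlgHom.norm_apply_le R.π a

theorem norm_ψ_le (R : CovariantRep hh) (x : C(Z, ℂ)) :
    ‖R.ψ x‖ ≤ Real.sqrt ‖bimoduleInner hh x x‖ := by
  apply Real.le_sqrt_of_sq_le
  rw [sq, ← CStarRing.norm_star_mul_self, ← R.inner]
  exact R.norm_π_le _

/-- The representation `(c ψ, π)`, for `c` in the unit circle. -/
noncomputable def twist (c : Circle) (R : CovariantRep hh) : CovariantRep hh where
  alg := R.alg
  π := R.π
  ψ := (c : ℂ) • R.ψ
  left a x := by simp [R.left]
  right x b := by simp [R.right]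
  inner x y := by
    rw [R.inner]
    simp only [LinearMap.smul_apply, star_smul, smul_mul_smul_comm]
    rw [show star (c : ℂ) * (c : ℂ) = 1 by
      rw [Complex.star_def, mul_comm, Complex.mul_conj, Circle.normSq_coe]; simp, one_smul]
  covariant a n x y H := by
    rw [R.covariant a n x y H]
    refine Finset.sum_congr rfl fun i _ => ?_
    simp only [LinearMap.smul_apply, star_smul, smul_mul_smul_comm]
    rw [show (c : ℂ) * star (c : ℂ) = 1 by
      rw [Complex.star_def, Complex.mul_conj, Circle.normSq_coe]; simp, one_smul]

theorem ext_of_ψ (R : CovariantRep hh) {ψ₁ ψ₂ : C(Z, ℂ) →ₗ[ℂ] R.alg} (hψ : ψ₁ = ψ₂)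
    {l₁ r₁ i₁ c₁ l₂ r₂ i₂ c₂} :
    (⟨R.alg, R.π, ψ₁, l₁, r₁, i₁, c₁⟩ : CovariantRep hh) = ⟨R.alg, R.π, ψ₂, l₂, r₂, i₂, c₂⟩ := by
  subst hψ
  rfl

theorem twist_twist (c d : Circle) (R : CovariantRep hh) :
    (R.twist c).twist d = R.twist (d * c) :=
  R.ext_of_ψ (LinearMap.ext fun x => by
    change (d : ℂ) • ((c : ℂ) • R.ψ x) = ((d * c : Circle) : ℂ) • R.ψ x
    rw [Circle.coe_mul, mul_smul])

theorem twist_one (R : CovariantRep hh) : R.twist 1 = R :=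
  R.ext_of_ψ (LinearMap.ext fun x => by
    change ((1 : Circle) : ℂ) • R.ψ x = R.ψ x
    rw [Circle.coe_one, one_smul])

end CovariantRep

/-- The C*-algebra of bounded families indexed by all covariant representations of `X`. -/
abbrev RepProduct (hh : IsLocalHomeomorph h) : Type (u + 1) :=
  lp (fun R : CovariantRep hh => R.alg) ∞

noncomputable instance RepProduct.cstar (hh : IsLocalHomeomorph h) :
    CStarAlgebra (RepProduct hh) := {}

namespace RepProduct

/-- The family `(π_R(a))_R` over all covariant representations `R`. -/
noncomputable def π (hh : IsLocalHomeomorph h) (a : C(Z, ℂ)) : RepProduct hh :=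
  ⟨fun R => R.π a, memℓp_infty ⟨‖a‖, by rintro _ ⟨R, rfl⟩; exact R.norm_π_le a⟩⟩

/-- The family `(ψ_R(x))_R` over all covariant representations `R`. -/
noncomputable def ψ (hh : IsLocalHomeomorph h) (x : C(Z, ℂ)) : RepProduct hh :=
  ⟨fun R => R.ψ x, memℓp_infty ⟨_, by rintro _ ⟨R, rfl⟩; exact R.norm_ψ_le x⟩⟩

/-- Reindexing along `R ↦ R.twist c`. -/
noncomputable def twist (hh : IsLocalHomeomorph h) (c : Circle) :
    RepProduct hh →⋆ₐ[ℂ] RepProduct hh where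
  toFun b := ⟨fun R => b (R.twist c), memℓp_infty ⟨‖b‖, by
    rintro _ ⟨R, rfl⟩; exact lp.norm_apply_le_norm (by simp) b (R.twist c)⟩⟩
  map_one' := rfl
  map_mul' _ _ := rfl
  map_zero' := rfl
  map_add' _ _ := rfl
  commutes' _ := rfl
  map_star' _ := rfl

end RepProduct

/-- The Cuntz-Pimsner algebra `O(X)`: the C*-algebra generated by the universal covariant
representation of `X`, realised as the direct sum of all covariant representations. -/
noncomputable def cuntzPimsner (hh : IsLocalHomeomorph h) : StarSubalgebra ℂ (RepProduct hh) :=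
  (StarAlgebra.adjoin ℂ
    (Set.range (RepProduct.π hh) ∪ Set.range (RepProduct.ψ hh))).topologicalClosure

/-- The underlying type of the Cuntz-Pimsner algebra `O(X)`. -/
abbrev CuntzPimsner (hh : IsLocalHomeomorph h) : Type (u + 1) := cuntzPimsner hh

noncomputable instance CuntzPimsner.cstar (hh : IsLocalHomeomorph h) :
    CStarAlgebra (CuntzPimsner hh) :=
  haveI : IsClosed (cuntzPimsner hh : Set (RepProduct hh)) :=
    StarSubalgebra.isClosed_topologicalClosure _
  StarSubalgebra.cstarAlgebra (cuntzPimsner hh)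

namespace CuntzPimsner

/-- The canonical map `π : C(Z) → O(X)`. -/
noncomputable def π (hh : IsLocalHomeomorph h) (a : C(Z, ℂ)) : CuntzPimsner hh :=
  ⟨RepProduct.π hh a, subset_closure (StarAlgebra.subset_adjoin ℂ _ (Or.inl ⟨a, rfl⟩))⟩

/-- The canonical map `ψ : X → O(X)`. -/
noncomputable def ψ (hh : IsLocalHomeomorph h) (x : C(Z, ℂ)) : CuntzPimsner hh :=
  ⟨RepProduct.ψ hh x, subset_closure (StarAlgebra.subset_adjoin ℂ _ (Or.inr ⟨x, rfl⟩))⟩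

theorem twist_mem (hh : IsLocalHomeomorph h) (c : Circle) (b : RepProduct hh)
    (hb : b ∈ cuntzPimsner hh) : RepProduct.twist hh c b ∈ cuntzPimsner hh := by
  have hcont : Continuous (RepProduct.twist hh c) :=
    AddMonoidHomClass.continuous_of_bound (RepProduct.twist hh c) 1 fun b => by
      rw [one_mul]; exact NonUnitalStarAlgHom.norm_apply_le (RepProduct.twist hh c) b
  have hle : StarAlgebra.adjoin ℂ (Set.range (RepProduct.π hh) ∪ Set.range (RepProduct.ψ hh)) ≤
      (cuntzPimsner hh).comap (RepProduct.twist hh c) := by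
    refine StarAlgebra.adjoin_le ?_
    rintro _ (⟨a, rfl⟩ | ⟨x, rfl⟩)
    · exact (π hh a).2
    · exact (cuntzPimsner hh).smul_mem (ψ hh x).2 (c : ℂ)
  exact StarSubalgebra.topologicalClosure_minimal hle
    ((StarSubalgebra.isClosed_topologicalClosure _).preimage hcont) hb

/-- The gauge action on `O(X)` as an endomorphism for each point of the circle. -/
noncomputable def gaugeHom (hh : IsLocalHomeomorph h) (c : Circle) :
    CuntzPimsner hh →⋆ₐ[ℂ] CuntzPimsner hh where
  toFun b := ⟨RepProduct.twist hh c b, twist_mem hh c b b.2⟩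
  map_one' := rfl
  map_mul' _ _ := rfl
  map_zero' := rfl
  map_add' _ _ := rfl
  commutes' _ := rfl
  map_star' _ := rfl

theorem gaugeHom_comp (hh : IsLocalHomeomorph h) (c d : Circle) (b : CuntzPimsner hh) :
    gaugeHom hh c (gaugeHom hh d b) = gaugeHom hh (c * d) b := by
  apply Subtype.ext
  apply lp.ext
  funext R
  refine eq_of_heq (?_ : HEq (b.1 ((R.twist c).twist d)) (b.1 (R.twist (c * d))))
  rw [R.twist_twist, mul_comm]

theorem gaugeHom_one (hh : IsLocalHomeomorph h) (b : CuntzPimsner hh) :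
    gaugeHom hh 1 b = b := by
  apply Subtype.ext
  apply lp.ext
  funext R
  refine eq_of_heq (?_ : HEq (b.1 (R.twist 1)) (b.1 R))
  rw [R.twist_one]

/-- The gauge action `γ` of the circle on `O(X)`. -/
noncomputable def gauge (hh : IsLocalHomeomorph h) (c : Circle) :
    CuntzPimsner hh ≃⋆ₐ[ℂ] CuntzPimsner hh :=
  StarAlgEquiv.ofStarAlgHom (gaugeHom hh c) (gaugeHom hh c⁻¹)
    (by ext1 b; simp [gaugeHom_comp, gaugeHom_one]) (by ext1 b; simp [gaugeHom_comp, gaugeHom_one])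

theorem gauge_π (hh : IsLocalHomeomorph h) (c : Circle) (a : C(Z, ℂ)) :
    gauge hh c (π hh a) = π hh a := rfl

theorem gauge_ψ (hh : IsLocalHomeomorph h) (c : Circle) (x : C(Z, ℂ)) :
    gauge hh c (ψ hh x) = (c : ℂ) • ψ hh x := rfl

/-- The dynamics `α_t = γ_{e^{it}}` on `O(X)`. -/
noncomputable def dynamics (hh : IsLocalHomeomorph h) (t : ℝ) :
    CuntzPimsner hh ≃⋆ₐ[ℂ] CuntzPimsner hh :=
  gauge hh (Circle.exp t)

/-- The set of inverse temperatures `β` at which `(O(X), α)` has a KMS state. -/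
def inverseTemperatures (hh : IsLocalHomeomorph h) : Set ℝ :=
  {β | ∃ φ : CuntzPimsner hh →ₗ[ℂ] ℂ, IsKMSState (dynamics hh) β φ}

end CuntzPimsner

end CuntzPimsner

/-! ### Thomsen's bounds -/

section Bounds

/-- `|h^{-n}(z)|`, the number of points `w` with `h^n(w) = z`. -/
noncomputable def fiberCard {Z : Type*} (h : Z → Z) (n : ℕ) (z : Z) : ℕ :=
  ((h^[n]) ⁻¹' {z}).ncard

/-- Thomsen's upper bound `β_c = limsup_n (1/n) ln (max_z |h^{-n}(z)|)`. -/
noncomputable def thomsenUpper {Z : Type*} (h : Z → Z) : ℝ :=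
  limsup (fun n : ℕ => (n : ℝ)⁻¹ * Real.log ((⨆ z, fiberCard h n z : ℕ) : ℝ)) atTop

/-- Thomsen's lower bound `β_l = limsup_n (1/n) ln (min_z |h^{-n}(z)|)`. -/
noncomputable def thomsenLower {Z : Type*} (h : Z → Z) : ℝ :=
  limsup (fun n : ℕ => (n : ℝ)⁻¹ * Real.log ((⨅ z, fiberCard h n z : ℕ) : ℝ)) atTop

end Bounds

/-! ### Shifts on path spaces of directed graphs -/

section Graphs

/-- A directed graph with vertex set `V`, edge set `E`, and range and source maps `r`, `s`. -/
structure DirectedGraph (V E : Type*) where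
  r : E → V
  s : E → V

namespace DirectedGraph

variable {V E : Type*} (G : DirectedGraph V E)

/-- The infinite-path space: sequences `x₀ x₁ x₂ ⋯` of edges with `s(xᵢ) = r(xᵢ₊₁)`, with the
topology inherited from the product space (`E` will carry the discrete topology). -/
def InfinitePath : Type _ := {x : ℕ → E // ∀ i, G.s (x i) = G.r (x (i + 1))}

instance [TopologicalSpace E] : TopologicalSpace G.InfinitePath :=
  inferInstanceAs (TopologicalSpace {x : ℕ → E // ∀ i, G.s (x i) = G.r (x (i + 1))})

instance [TopologicalSpace E] [T2Space E] : T2Space G.InfinitePath :=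
  inferInstanceAs (T2Space {x : ℕ → E // ∀ i, G.s (x i) = G.r (x (i + 1))})

instance [TopologicalSpace E] [DiscreteTopology E] [Finite E] : CompactSpace G.InfinitePath := by
  have heq : {x : ℕ → E | ∀ i, G.s (x i) = G.r (x (i + 1))} =
      ⋂ i, {x : ℕ → E | G.s (x i) = G.r (x (i + 1))} := by
    ext x
    simp
  suffices hcl : IsClosed {x : ℕ → E | ∀ i, G.s (x i) = G.r (x (i + 1))} from
    isCompact_iff_compactSpace.1 hcl.isCompact
  rw [heq]
  refine isClosed_iInter fun i => ?_
  have hc : Continuous fun x : ℕ → E => (x i, x (i + 1)) := by fun_prop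
  exact (isClosed_discrete {p : E × E | G.s p.1 = G.r p.2}).preimage hc

/-- The backward shift `σ(e₁ e₂ e₃ ⋯) = e₂ e₃ ⋯`. -/
def shift (x : G.InfinitePath) : G.InfinitePath :=
  ⟨fun i => x.1 (i + 1), fun i => x.2 (i + 1)⟩

theorem isLocalHomeomorph_shift [TopologicalSpace E] [DiscreteTopology E] [Finite E] :
    IsLocalHomeomorph G.shift := by
  have hev : ∀ i, Continuous fun x : G.InfinitePath => x.1 i := fun i =>
    (continuous_apply i).comp continuous_subtype_val
  have hσ : Continuous G.shift :=
    Continuous.subtype_mk (continuous_pi fun i => hev (i + 1)) _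
  rw [isLocalHomeomorph_iff_isOpenEmbedding_restrict]
  intro x
  set U : Set G.InfinitePath := (fun y : G.InfinitePath => y.1 0) ⁻¹' {x.1 0} with hUdef
  have hUo : IsOpen U := (isOpen_discrete _).preimage (hev 0)
  have hUc : IsClosed U := (isClosed_discrete _).preimage (hev 0)
  have : CompactSpace U := isCompact_iff_compactSpace.1 hUc.isCompact
  have hcont : Continuous (U.domRestrict G.shift) := hσ.comp continuous_subtype_val
  have hinj : Function.Injective (U.domRestrict G.shift) := by
    rintro ⟨y, hy⟩ ⟨z, hz⟩ hyz
    have hyz' : G.shift y = G.shift z := hyz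
    apply Subtype.ext
    apply Subtype.ext
    funext i
    cases i with
    | zero => exact (show y.1 0 = x.1 0 from hy).trans (show z.1 0 = x.1 0 from hz).symm
    | succ i => exact congrFun (congrArg Subtype.val hyz') i
  refine ⟨U, hUo.mem_nhds rfl, (hcont.isClosedEmbedding hinj).isEmbedding, ?_⟩
  have hr : Set.range (U.domRestrict G.shift) =
      (fun y : G.InfinitePath => y.1 0) ⁻¹' {e | G.s (x.1 0) = G.r e} := by
    ext y
    constructor
    · rintro ⟨⟨z, hz⟩, rfl⟩
      have h0 : z.1 0 = x.1 0 := hz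
      change G.s (x.1 0) = G.r (z.1 1)
      rw [← h0]
      exact z.2 0
    · intro hy
      let z : G.InfinitePath := ⟨fun i => Nat.casesOn i (x.1 0) y.1, fun i => by
        cases i with
        | zero => exact hy
        | succ i => exact y.2 i⟩
      exact ⟨⟨z, show z.1 0 = x.1 0 from rfl⟩, rfl⟩
  rw [hr]
  exact (isOpen_discrete _).preimage (hev 0)

end DirectedGraph

/-- The vertices of the dumbbell graph. -/
inductive DumbbellVertex
  | v
  | w

/-- The edges of the dumbbell graph: two loops at `v`, three loops at `w`, and one edge `bar` with
source `w` and range `v`. -/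
inductive DumbbellEdge
  | loopV (i : Fin 2)
  | loopW (i : Fin 3)
  | bar

instance : TopologicalSpace DumbbellEdge := ⊥

instance : DiscreteTopology DumbbellEdge := ⟨rfl⟩

instance : Finite DumbbellEdge :=
  Finite.of_surjective
    (fun x : (Fin 2 ⊕ Fin 3) ⊕ Unit => match x with
      | .inl (.inl i) => DumbbellEdge.loopV i
      | .inl (.inr i) => DumbbellEdge.loopW i
      | .inr _ => DumbbellEdge.bar)
    (fun e => by
      cases e with
      | loopV i => exact ⟨.inl (.inl i), rfl⟩
      | loopW i => exact ⟨.inl (.inr i), rfl⟩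
      | bar => exact ⟨.inr (), rfl⟩)

/-- The dumbbell graph. -/
def dumbbell : DirectedGraph DumbbellVertex DumbbellEdge where
  r
    | .loopV _ => .v
    | .loopW _ => .w
    | .bar => .v
  s
    | .loopV _ => .v
    | .loopW _ => .w
    | .bar => .w

end Graphs

/-! ### Counting points in fibres -/

section Counting

variable {Z : Type*} {h : Z → Z}

/-! Let `L` be the transfer operator, `(L f)(z) = ∑_{h(w) = z} f(w)`, so that `L^n 1` is the
function `z ↦ |h^{-n}(z)|`. Inverse temperatures correspond to positive eigenfunctionals of `L`.

Let `φ` be KMS at `β`. Choose functions `u_i` with `∑ u_i² = 1`, each supported where `h` is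
injective. Then `π(a) = ∑ ψ(a u_i) ψ(u_i)*` and `π(L a) = ∑ ψ(u_i)* ψ(a u_i)`, and the KMS condition
exchanges the factors, so `φ ∘ π ∘ L = e^β φ ∘ π` (`kms_π_fiberSum`). Evaluating at `L^n 1` places
`e^{nβ}` between the minimum and the maximum of `|h^{-n}(z)|`; both bounds follow.

Conversely, represent `O(X)` on `ℓ²(Z)` by multiplications and weighted compositions with `h`
(`pointRep`). The diagonal of an operator is only a bounded function, so take a positive normalised
`τ` on `ℓ^∞(Z)` with `τ ∘ L = e^β τ`. Composing it with the diagonal and averaging over the gauge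
action gives a KMS state at `β` (`mem_inverseTemperatures_of_eigenstate`). By M. Riesz's extension
theorem such a `τ` exists unless some bounded real `u` satisfies `L u ≥ e^β u + ε` with `ε > 0`
(`exists_eigenstate`). Iterating that inequality bounds sums of normalised fibre counts, which rules
`u` out in two cases: at `e^β = e^{β_c}`, by Fekete's lemma, and at `e^β = r` if a single point has
`|h^{-n}(z)| = r^n` for all `n`. For the dumbbell, a path of loops at `v` is such a point with `r =
2`, so the lower bound is attained as well. -/

theorem finite_fiber_iterate (hf : ∀ z, (h ⁻¹' {z}).Finite) (n : ℕ) (z : Z) :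
    ((h^[n]) ⁻¹' {z}).Finite := by
  induction n generalizing z with
  | zero => simp
  | succ n ih =>
    rw [Function.iterate_succ', Set.preimage_comp]
    exact (hf z).preimage' fun w _ => ih w

theorem fiberCard_zero (z : Z) : fiberCard h 0 z = 1 := by
  simp [fiberCard]

theorem fiberCard_succ (hf : ∀ z, (h ⁻¹' {z}).Finite) (n : ℕ) (z : Z) :
    fiberCard h (n + 1) z = ∑ w ∈ (hf z).toFinset, fiberCard h n w := by
  have hU : (h^[n + 1]) ⁻¹' {z} = ⋃ w ∈ h ⁻¹' {z}, (h^[n]) ⁻¹' {w} := by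
    ext y
    simp only [Set.mem_preimage, Set.mem_singleton_iff, Set.mem_iUnion, exists_prop,
      Function.iterate_succ_apply', exists_eq_right']
  rw [fiberCard, hU, (hf z).ncard_biUnion (fun w _ => finite_fiber_iterate hf n w),
    finsum_mem_eq_finite_toFinset_sum _ (hf z)]
  · rfl
  · intro a _ b _ hab
    exact Set.disjoint_left.2 fun y hya hyb => hab (hya.symm.trans hyb)

theorem fiberCard_pos (hf : ∀ z, (h ⁻¹' {z}).Finite) (hs : Function.Surjective h) (n : ℕ) (z : Z) :
    0 < fiberCard h n z := by
  obtain ⟨w, hw⟩ := hs.iterate n z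
  exact (Set.ncard_pos (finite_fiber_iterate hf n z)).2 ⟨w, hw⟩

/-- `h^{-(n+k)}(z)` is the union of the fibres `h^{-k}(w)` over `w ∈ h^{-n}(z)`. The point `z` stays
fixed, so this yields submultiplicativity of the maxima and also lower bounds on `|h^{-n}(z)|`. -/
theorem fiberCard_add_le (hf : ∀ z, (h ⁻¹' {z}).Finite) {M k : ℕ} (hM : ∀ z, fiberCard h k z ≤ M)
    (n : ℕ) (z : Z) : fiberCard h (n + k) z ≤ M * fiberCard h n z := by
  induction n generalizing z with
  | zero => simpa [fiberCard_zero] using hM z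
  | succ n ih =>
    rw [Nat.add_right_comm, fiberCard_succ hf, fiberCard_succ hf, Finset.mul_sum]
    exact Finset.sum_le_sum fun w _ => ih w

theorem bddAbove_fiberCard (hf : ∀ z, (h ⁻¹' {z}).Finite)
    (hb : BddAbove (Set.range (fiberCard h 1))) (n : ℕ) :
    BddAbove (Set.range (fiberCard h n)) := by
  obtain ⟨N, hN⟩ := hb
  have hN' : ∀ z, fiberCard h 1 z ≤ N := fun z => hN ⟨z, rfl⟩
  refine ⟨N ^ n, ?_⟩
  rintro _ ⟨z, rfl⟩
  induction n generalizing z with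
  | zero => simp [fiberCard_zero]
  | succ n ih =>
    rw [pow_succ']
    exact (fiberCard_add_le hf hN' n z).trans (Nat.mul_le_mul_left _ (ih z))

theorem le_iSup_fiberCard (hf : ∀ z, (h ⁻¹' {z}).Finite)
    (hb : BddAbove (Set.range (fiberCard h 1))) (n : ℕ) (z : Z) :
    fiberCard h n z ≤ ⨆ z, fiberCard h n z :=
  le_ciSup (bddAbove_fiberCard hf hb n) z

theorem iSup_fiberCard_pos [Nonempty Z] (hf : ∀ z, (h ⁻¹' {z}).Finite)
    (hb : BddAbove (Set.range (fiberCard h 1))) (hs : Function.Surjective h) (n : ℕ) :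
    0 < ⨆ z, fiberCard h n z :=
  (fiberCard_pos hf hs n (Classical.arbitrary Z)).trans_le (le_iSup_fiberCard hf hb n _)

theorem exists_fiberCard_eq_iSup [Nonempty Z] (hf : ∀ z, (h ⁻¹' {z}).Finite)
    (hb : BddAbove (Set.range (fiberCard h 1))) (n : ℕ) :
    ∃ z, fiberCard h n z = ⨆ z, fiberCard h n z :=
  Nat.sSup_mem (Set.range_nonempty _) (bddAbove_fiberCard hf hb n)

theorem subadditive_log_iSup_fiberCard [Nonempty Z] (hf : ∀ z, (h ⁻¹' {z}).Finite)
    (hb : BddAbove (Set.range (fiberCard h 1))) (hs : Function.Surjective h) :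
    Subadditive fun n => Real.log ((⨆ z, fiberCard h n z : ℕ) : ℝ) := by
  intro m n
  have hpos : ∀ n, (0 : ℝ) < (⨆ z, fiberCard h n z : ℕ) := fun n => by
    exact_mod_cast iSup_fiberCard_pos hf hb hs n
  rw [← Real.log_mul (hpos m).ne' (hpos n).ne']
  refine Real.log_le_log (hpos _) ?_
  have : (⨆ z, fiberCard h (m + n) z) ≤ (⨆ z, fiberCard h m z) * ⨆ z, fiberCard h n z :=
    ciSup_le fun z => by
      rw [mul_comm]
      exact (fiberCard_add_le hf (le_iSup_fiberCard hf hb n) m z).trans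
        (Nat.mul_le_mul_left _ (le_iSup_fiberCard hf hb m z))
  exact_mod_cast this

theorem bddBelow_log_iSup_fiberCard :
    BddBelow (Set.range fun n : ℕ => Real.log ((⨆ z, fiberCard h n z : ℕ) : ℝ) / n) :=
  ⟨0, by rintro _ ⟨n, rfl⟩; exact div_nonneg (Real.log_natCast_nonneg _) n.cast_nonneg⟩

/-- Fekete's lemma: the limsup defining `β_c` is a limit, and also the infimum of the terms with `n
≥ 1`. -/
theorem tendsto_thomsenUpper [Nonempty Z] (hf : ∀ z, (h ⁻¹' {z}).Finite)
    (hb : BddAbove (Set.range (fiberCard h 1))) (hs : Function.Surjective h) :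
    Tendsto (fun n : ℕ => Real.log ((⨆ z, fiberCard h n z : ℕ) : ℝ) / n) atTop
      (𝓝 (thomsenUpper h)) := by
  have ht := (subadditive_log_iSup_fiberCard hf hb hs).tendsto_lim bddBelow_log_iSup_fiberCard
  have : thomsenUpper h = (subadditive_log_iSup_fiberCard hf hb hs).lim := by
    rw [← ht.limsup_eq, thomsenUpper]
    simp_rw [div_eq_inv_mul]
  rwa [this]

theorem exp_thomsenUpper_pow_le [Nonempty Z] (hf : ∀ z, (h ⁻¹' {z}).Finite)
    (hb : BddAbove (Set.range (fiberCard h 1))) (hs : Function.Surjective h) (n : ℕ) :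
    Real.exp (thomsenUpper h) ^ n ≤ (⨆ z, fiberCard h n z : ℕ) := by
  rcases Nat.eq_zero_or_pos n with rfl | hn
  · rw [pow_zero]
    exact_mod_cast iSup_fiberCard_pos hf hb hs 0
  have hlim : (subadditive_log_iSup_fiberCard hf hb hs).lim = thomsenUpper h :=
    tendsto_nhds_unique ((subadditive_log_iSup_fiberCard hf hb hs).tendsto_lim
      bddBelow_log_iSup_fiberCard) (tendsto_thomsenUpper hf hb hs)
  have hle := (subadditive_log_iSup_fiberCard hf hb hs).lim_le_div bddBelow_log_iSup_fiberCard hn.ne'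
  have hn' : (0 : ℝ) < n := by exact_mod_cast hn
  rw [hlim, le_div_iff₀ hn'] at hle
  rw [← Real.exp_nat_mul, mul_comm]
  exact (Real.exp_le_exp.2 hle).trans_eq
    (Real.exp_log (by exact_mod_cast iSup_fiberCard_pos hf hb hs n))

end Counting

/-! ### Strict sub-eigenvectors of the transfer operator -/

section SubEigenvector

variable {Z : Type*} {h : Z → Z}

/-- The transfer operator `(L f)(z) = ∑_{h(w) = z} f(w)` of a map with finite fibres. -/
noncomputable def transfer {M : Type*} [AddCommMonoid M] (hf : ∀ z, (h ⁻¹' {z}).Finite)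
    (f : Z → M) (z : Z) : M :=
  ∑ w ∈ (hf z).toFinset, f w

/-- Iterate `u ≤ r⁻¹ L u - ε / r`. The operator `L` is positive and `L^k 1` counts fibres, so each
round contributes one more term `|h^{-k}(z)| / r^k`. -/
theorem add_sum_fiberCard_div_le (hf : ∀ z, (h ⁻¹' {z}).Finite) {r ε C : ℝ} (hr : 0 < r)
    {u : Z → ℝ} (huC : ∀ z, u z ≤ C) (hu : ∀ z, r * u z + ε ≤ transfer hf u z) (n : ℕ) (z : Z) :
    u z + ε / r * ∑ k ∈ Finset.range n, (fiberCard h k z : ℝ) / r ^ k ≤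
      C * ((fiberCard h n z : ℝ) / r ^ n) := by
  induction n generalizing z with
  | zero => simpa [fiberCard_zero] using huC z
  | succ n ih =>
    have hc : ∀ k, (fiberCard h (k + 1) z : ℝ) / r ^ (k + 1) =
        r⁻¹ * ∑ w ∈ (hf z).toFinset, (fiberCard h k w : ℝ) / r ^ k := fun k => by
      rw [fiberCard_succ hf, ← Finset.sum_div]
      push_cast
      rw [pow_succ]
      field_simp
    calc u z + ε / r * ∑ k ∈ Finset.range (n + 1), (fiberCard h k z : ℝ) / r ^ k
        = r⁻¹ * (r * u z + ε) + ε / r * ∑ k ∈ Finset.range n,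
            (fiberCard h (k + 1) z : ℝ) / r ^ (k + 1) := by
          rw [Finset.sum_range_succ', fiberCard_zero]
          field_simp
          simp
          ring
      _ ≤ r⁻¹ * transfer hf u z + ε / r * ∑ k ∈ Finset.range n,
            (fiberCard h (k + 1) z : ℝ) / r ^ (k + 1) := by
          gcongr
          exact hu z
      _ = r⁻¹ * ∑ w ∈ (hf z).toFinset,
            (u w + ε / r * ∑ k ∈ Finset.range n, (fiberCard h k w : ℝ) / r ^ k) := by
          simp_rw [hc, transfer, Finset.sum_add_distrib, ← Finset.mul_sum]
          rw [Finset.sum_comm]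
          ring
      _ ≤ r⁻¹ * ∑ w ∈ (hf z).toFinset, C * ((fiberCard h n w : ℝ) / r ^ n) := by
          gcongr with w
          exact ih w
      _ = C * ((fiberCard h (n + 1) z : ℝ) / r ^ (n + 1)) := by
          rw [hc, ← Finset.mul_sum]
          ring

/-- There is no strict sub-eigenvector at `r` if some fibre grows like `r ^ n`. -/
theorem not_exists_subEigenvector_of_fiberCard_eq (hf : ∀ z, (h ⁻¹' {z}).Finite) {r : ℝ}
    (hr : 0 < r) {z : Z} (hz : ∀ n, (fiberCard h n z : ℝ) = r ^ n) {u : Z → ℝ} {C ε : ℝ}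
    (huC : ∀ z, u z ≤ C) (hε : 0 < ε) (hu : ∀ z, r * u z + ε ≤ transfer hf u z) : False := by
  -- All normalised counts at `z` equal `1`, so the bound reads `u z + n ε / r ≤ C`, which fails for
  -- large `n`.
  obtain ⟨n, hn⟩ := exists_nat_gt ((C - u z) / (ε / r))
  have := add_sum_fiberCard_div_le hf hr huC hu n z
  have h1 : ∀ k, (fiberCard h k z : ℝ) / r ^ k = 1 := fun k => by
    rw [hz, div_self (pow_pos hr k).ne']
  simp only [h1, Finset.sum_const, Finset.card_range, nsmul_eq_mul, mul_one] at this
  rw [div_lt_iff₀ (by positivity)] at hn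
  linarith

/-- With `a_k = |h^{-k}(z)| / r^k` and `S_n = ∑_{k<n} a_k`, the hypothesis gives `a_n ≥ δ S_n - 1`.
Once `δ S_n - 1` is positive, it grows at least by the factor `1 + δ` at each step. Then
`|h^{-n}(z)|` has exponential growth rate at least `β_c + ln (1 + δ)`, which exceeds the maximal
rate. -/
theorem sum_fiberCard_div_le [Nonempty Z] (hf : ∀ z, (h ⁻¹' {z}).Finite)
    (hb : BddAbove (Set.range (fiberCard h 1))) (hs : Function.Surjective h) {δ : ℝ} (hδ : 0 < δ)
    (H : ∀ n z, δ * ∑ k ∈ Finset.range n, (fiberCard h k z : ℝ) / Real.exp (thomsenUpper h) ^ k ≤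
      (fiberCard h n z : ℝ) / Real.exp (thomsenUpper h) ^ n + 1) (n : ℕ) (z : Z) :
    δ * ∑ k ∈ Finset.range n, (fiberCard h k z : ℝ) / Real.exp (thomsenUpper h) ^ k ≤ 1 := by
  set r := Real.exp (thomsenUpper h) with hrdef
  set S : ℕ → ℝ := fun n => ∑ k ∈ Finset.range n, (fiberCard h k z : ℝ) / r ^ k with hS
  have hr : 0 < r := Real.exp_pos _
  by_contra! hlt
  have hη : 0 < δ * S n - 1 := by linarith
  have hgrow : ∀ j, (1 + δ) ^ j * (δ * S n - 1) ≤ δ * S (n + j) - 1 := fun j => by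
    induction j with
    | zero => simp
    | succ j ih =>
      have h1 := H (n + j) z
      have h2 : S (n + (j + 1)) = S (n + j) + (fiberCard h (n + j) z : ℝ) / r ^ (n + j) :=
        Finset.sum_range_succ _ _
      rw [h2]
      have h3 : δ * (δ * S (n + j) - 1) ≤ δ * ((fiberCard h (n + j) z : ℝ) / r ^ (n + j)) :=
        mul_le_mul_of_nonneg_left (by linarith [H (n + j) z]) hδ.le
      have h4 : (1 + δ) * ((1 + δ) ^ j * (δ * S n - 1)) ≤ (1 + δ) * (δ * S (n + j) - 1) :=
        mul_le_mul_of_nonneg_left ih (by linarith)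
      rw [pow_succ']
      linarith
  have hM : ∀ j : ℕ, (n + j : ℕ) * thomsenUpper h + (j * Real.log (1 + δ) + Real.log (δ * S n - 1))
      ≤ Real.log ((⨆ z, fiberCard h (n + j) z : ℕ) : ℝ) := fun j => by
    rw [← Real.log_pow, ← Real.log_mul (by positivity) hη.ne',
      ← Real.log_exp ((n + j : ℕ) * thomsenUpper h), ← Real.log_mul (Real.exp_ne_zero _) (by positivity)]
    refine Real.log_le_log (by positivity) ?_
    have h1 : (1 + δ) ^ j * (δ * S n - 1) ≤ (fiberCard h (n + j) z : ℝ) / r ^ (n + j) := by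
      linarith [hgrow j, H (n + j) z]
    rw [Real.exp_nat_mul, ← hrdef]
    rw [le_div_iff₀ (by positivity)] at h1
    rw [mul_comm]
    exact h1.trans (by exact_mod_cast le_iSup_fiberCard hf hb (n + j) z)
  have ht := tendsto_thomsenUpper hf hb hs
  -- The part of the lower bound in `hM` that does not depend on `j`, once it is written in terms of
  -- `m = n + j`; it disappears after division by `m`.
  set K := n * thomsenUpper h + Real.log (δ * S n - 1) - n * (thomsenUpper h + Real.log (1 + δ))
  have hlow : ∀ᶠ m : ℕ in atTop, thomsenUpper h + Real.log (1 + δ) + K / m ≤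
      Real.log ((⨆ z, fiberCard h m z : ℕ) : ℝ) / m := by
    filter_upwards [eventually_ge_atTop (n + 1)] with m hm
    obtain ⟨j, rfl⟩ := Nat.exists_eq_add_of_le (Nat.le_of_succ_le hm)
    have hpos : (0 : ℝ) < (n + j : ℕ) := by exact_mod_cast (by omega : 0 < n + j)
    rw [le_div_iff₀ hpos, add_mul, div_mul_cancel₀ _ hpos.ne']
    refine le_trans (le_of_eq ?_) (hM j)
    simp only [K]
    push_cast
    ring
  have hK : Tendsto (fun m : ℕ => thomsenUpper h + Real.log (1 + δ) + K / m) atTop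
      (𝓝 (thomsenUpper h + Real.log (1 + δ) + 0)) :=
    tendsto_const_nhds.add (tendsto_const_div_atTop_nhds_zero_nat K)
  have := le_of_tendsto_of_tendsto hK ht hlow
  have hlog : 0 < Real.log (1 + δ) := Real.log_pos (by linarith)
  linarith

/-- There is no bounded strict sub-eigenvector of the transfer operator at its spectral radius. -/
theorem not_exists_subEigenvector_thomsenUpper [Nonempty Z] (hf : ∀ z, (h ⁻¹' {z}).Finite)
    (hb : BddAbove (Set.range (fiberCard h 1))) (hs : Function.Surjective h)
    {u : Z → ℝ} {C ε : ℝ} (huC : ∀ z, |u z| ≤ C) (hε : 0 < ε)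
    (hu : ∀ z, Real.exp (thomsenUpper h) * u z + ε ≤ transfer hf u z) : False := by
  set r := Real.exp (thomsenUpper h) with hrdef
  have hr : 0 < r := Real.exp_pos _
  set D := |C| + 1
  have hD : 0 < D := by positivity
  have huD : ∀ z, |u z| ≤ D := fun z => (huC z).trans ((le_abs_self C).trans (by simp [D]))
  -- Dividing the iterated inequality by `D`, with `-D ≤ u ≤ D`, gives the hypothesis of
  -- `sum_fiberCard_div_le` for this `δ`.
  set δ := ε / r / D with hδdef
  have hδ : 0 < δ := by positivity
  have H : ∀ n z, δ * ∑ k ∈ Finset.range n, (fiberCard h k z : ℝ) / r ^ k ≤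
      (fiberCard h n z : ℝ) / r ^ n + 1 := fun n z => by
    have h1 := add_sum_fiberCard_div_le hf hr (fun z => (abs_le.1 (huD z)).2) hu n z
    have h2 := (abs_le.1 (huD z)).1
    rw [hδdef, div_mul_eq_mul_div, div_le_iff₀ hD]
    linarith
  have hS := sum_fiberCard_div_le hf hb hs hδ H
  -- One term of a bounded sum of nonnegative terms: `|h^{-n}(z)| ≤ r^n / δ` uniformly in `n` and
  -- `z`.
  have ha : ∀ n z, δ * ((fiberCard h n z : ℝ) / r ^ n) ≤ 1 := fun n z => by
    refine le_trans ?_ (hS (n + 1) z)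
    rw [Finset.sum_range_succ]
    have : 0 ≤ ∑ k ∈ Finset.range n, (fiberCard h k z : ℝ) / r ^ k := by positivity
    nlinarith
  obtain ⟨N, hN⟩ := exists_nat_gt (1 / (δ * δ))
  obtain ⟨z, hz⟩ := exists_fiberCard_eq_iSup hf hb N
  -- At a point with the largest `N`-th fibre, the earlier fibres are large too: `r^{n+k} ≤
  -- |h^{-(n+k)}(z)| ≤ (r^k / δ) |h^{-n}(z)|` for `n + k = N`. Hence `δ S_N ≥ δ² N > 1`,
  -- contradicting `hS`.
  have hterm : ∀ n ∈ Finset.range N, δ ≤ (fiberCard h n z : ℝ) / r ^ n := fun n hn => by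
    have hnN : n ≤ N := (Finset.mem_range.1 hn).le
    obtain ⟨k, rfl⟩ := Nat.exists_eq_add_of_le hnN
    obtain ⟨y, hy⟩ := exists_fiberCard_eq_iSup hf hb k
    have h1 : (fiberCard h (n + k) z : ℝ) ≤ fiberCard h k y * fiberCard h n z := by
      exact_mod_cast fiberCard_add_le hf (fun w => (le_iSup_fiberCard hf hb k w).trans_eq hy.symm) n z
    have h2 : r ^ (n + k) ≤ (fiberCard h (n + k) z : ℝ) := by
      rw [hz]; exact exp_thomsenUpper_pow_le hf hb hs _
    have h3 := ha k y
    rw [← mul_div_assoc, div_le_one (by positivity)] at h3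
    rw [le_div_iff₀ (by positivity)]
    have h4 : r ^ n * r ^ k ≤ fiberCard h k y * fiberCard h n z := by
      rw [← pow_add]; exact h2.trans h1
    have h5 : δ * (r ^ n * r ^ k) ≤ r ^ k * fiberCard h n z := by
      calc δ * (r ^ n * r ^ k) ≤ δ * (fiberCard h k y * fiberCard h n z) := by gcongr
        _ = (δ * fiberCard h k y) * fiberCard h n z := by ring
        _ ≤ r ^ k * fiberCard h n z := by gcongr
    have hrk : 0 < r ^ k := by positivity
    exact le_of_mul_le_mul_left (by linarith) hrk
  have hsum := Finset.card_nsmul_le_sum _ _ _ hterm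
  rw [Finset.card_range, nsmul_eq_mul] at hsum
  have := hS N z
  rw [div_lt_iff₀ (by positivity)] at hN
  nlinarith

end SubEigenvector

/-! ### Eigenstates of the transfer operator on bounded functions -/

section Eigenstate

variable {Z : Type*} {h : Z → Z}

theorem lp_infty_add_apply (f g : lp (fun _ : Z => ℂ) ∞) (z : Z) : (f + g) z = f z + g z := rfl

theorem lp_infty_sub_apply (f g : lp (fun _ : Z => ℂ) ∞) (z : Z) : (f - g) z = f z - g z := rfl

theorem lp_infty_neg_apply (f : lp (fun _ : Z => ℂ) ∞) (z : Z) : (-f) z = -f z := rfl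

theorem lp_infty_smul_apply (c : ℂ) (f : lp (fun _ : Z => ℂ) ∞) (z : Z) : (c • f) z = c * f z := rfl

theorem lp_infty_real_smul_apply (c : ℝ) (f : lp (fun _ : Z => ℂ) ∞) (z : Z) :
    (c • f) z = (c : ℂ) * f z :=
  Complex.real_smul

theorem transfer_mul_left (hf : ∀ z, (h ⁻¹' {z}).Finite) (c : ℂ) (f : Z → ℂ) (z : Z) :
    transfer hf (fun w => c * f w) z = c * transfer hf f z :=
  (Finset.mul_sum _ _ _).symm

/-- The cone of bounded functions that are positive modulo the range of `L - r`. -/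
noncomputable def eigenCone (hf : ∀ z, (h ⁻¹' {z}).Finite) (r : ℝ) :
    PointedCone ℝ (lp (fun _ : Z => ℂ) ∞) where
  carrier := {f | ∃ g k : lp (fun _ : Z => ℂ) ∞, (∀ z, k z = transfer hf g z) ∧
    ∀ z, 0 ≤ (f z + k z - r * g z).re}
  add_mem' := by
    rintro f f' ⟨g, k, hk, hp⟩ ⟨g', k', hk', hp'⟩
    refine ⟨g + g', k + k', fun z => ?_, fun z => ?_⟩
    · rw [lp_infty_add_apply, hk, hk']
      exact Finset.sum_add_distrib.symm
    · have h1 := hp z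
      have h2 := hp' z
      simp only [lp_infty_add_apply, Complex.add_re, Complex.sub_re, mul_add] at h1 h2 ⊢
      linarith
  zero_mem' := ⟨0, 0, fun z => by simp [transfer], fun z => by simp⟩
  smul_mem' := by
    rintro c f ⟨g, k, hk, hp⟩
    refine ⟨(c : ℝ) • g, (c : ℝ) • k, fun z => ?_, fun z => ?_⟩
    · rw [lp_infty_real_smul_apply, hk, ← transfer_mul_left]
      rfl
    · have h1 := mul_nonneg c.2 (hp z)
      change 0 ≤ (((c : ℝ) • f) z + ((c : ℝ) • k) z - r * ((c : ℝ) • g) z).re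
      simp only [lp_infty_real_smul_apply, Complex.add_re, Complex.sub_re, Complex.mul_re,
        Complex.ofReal_re, Complex.ofReal_im, zero_mul, sub_zero] at h1 ⊢
      linarith

theorem mem_eigenCone_of_nonneg (hf : ∀ z, (h ⁻¹' {z}).Finite) (r : ℝ)
    {f : lp (fun _ : Z => ℂ) ∞} (h0 : ∀ z, 0 ≤ (f z).re) : f ∈ eigenCone hf r :=
  ⟨0, 0, fun z => by simp [transfer], fun z => by simpa using h0 z⟩

/-- M. Riesz extension of `c · 1 ↦ c` from the line of constants. This is nonnegative on the cone
because a constant `c < 0` in the cone, with witness `g`, would make `Re g` a strict sub-eigenvector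
with gap `-c`. -/
theorem exists_real_eigenstate [Nonempty Z] (hf : ∀ z, (h ⁻¹' {z}).Finite) {r : ℝ}
    (H : ∀ (u : Z → ℝ) (C ε : ℝ), (∀ z, |u z| ≤ C) → 0 < ε →
      (∀ z, r * u z + ε ≤ transfer hf u z) → False) :
    ∃ t : Module.Dual ℝ (lp (fun _ : Z => ℂ) ∞), t 1 = 1 ∧ ∀ f ∈ eigenCone hf r, 0 ≤ t f := by
  have hone : (1 : lp (fun _ : Z => ℂ) ∞) ≠ 0 := fun h0 =>
    one_ne_zero (congrArg (fun f : lp (fun _ : Z => ℂ) ∞ => f (Classical.arbitrary Z)) h0)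
  have hval : ∀ (c : ℝ) (z : Z), (c • (1 : lp (fun _ : Z => ℂ) ∞)) z = (c : ℂ) := fun c z => by
    simp [lp.infty_coeFn_one]
  obtain ⟨t, ht, htpos⟩ := riesz_extension (eigenCone hf r)
    (LinearPMap.mkSpanSingleton (K := ℝ) (1 : lp (fun _ : Z => ℂ) ∞) (1 : ℝ) hone) (by
      rintro ⟨x, hx⟩ hmem
      obtain ⟨c, rfl⟩ := Submodule.mem_span_singleton.1 hx
      rw [LinearPMap.mkSpanSingleton'_apply]
      obtain ⟨g, k, hk, hp⟩ := hmem
      by_contra! hc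
      refine H (fun z => (g z).re) ‖g‖ (-c) (fun z => ?_) (by simpa using hc) fun z => ?_
      · exact (Complex.abs_re_le_norm _).trans (lp.norm_apply_le_norm (by simp) g z)
      · have h1 := hp z
        have h2 : transfer hf (fun z => (g z).re) z = (k z).re := by
          rw [hk, transfer, transfer, Complex.re_sum]
        rw [h2]
        simp only [hval] at h1
        simp at h1
        linarith)
    -- The constants are cofinal: `‖y‖ · 1 + y` has nonnegative real part.
    (fun y => ⟨⟨‖y‖ • 1, Submodule.smul_mem _ _ (Submodule.mem_span_singleton_self _)⟩, by
      refine mem_eigenCone_of_nonneg hf r fun z => ?_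
      have h1 := (Complex.abs_re_le_norm (y z)).trans (lp.norm_apply_le_norm (by simp) y z)
      change 0 ≤ ((‖y‖ • (1 : lp (fun _ : Z => ℂ) ∞)) z + y z).re
      rw [hval]
      have := (abs_le.1 h1).1
      simp only [Complex.add_re, Complex.ofReal_re]
      linarith⟩)
  refine ⟨t, ?_, htpos⟩
  have := ht ⟨(1 : ℝ) • 1, Submodule.smul_mem _ _ (Submodule.mem_span_singleton_self _)⟩
  rw [LinearPMap.mkSpanSingleton'_apply] at this
  simpa using this

/-- A positive functional on bounded functions with `τ (L f) = r τ(f)` exists as soon as there is no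
bounded real function `u` for which `L u - r u` is bounded below by a positive constant. -/
theorem exists_eigenstate [Nonempty Z] (hf : ∀ z, (h ⁻¹' {z}).Finite) {r : ℝ}
    (H : ∀ (u : Z → ℝ) (C ε : ℝ), (∀ z, |u z| ≤ C) → 0 < ε →
      (∀ z, r * u z + ε ≤ transfer hf u z) → False) :
    ∃ τ : lp (fun _ : Z => ℂ) ∞ →ₗ[ℂ] ℂ, τ 1 = 1 ∧ (∀ f, (∀ z, 0 ≤ f z) → 0 ≤ τ f) ∧
      (∀ f, ‖τ f‖ ≤ 2 * ‖f‖) ∧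
      ∀ f g : lp (fun _ : Z => ℂ) ∞, (∀ z, g z = transfer hf f z) → τ g = r * τ f := by
  obtain ⟨t, ht1, htpos⟩ := exists_real_eigenstate hf H
  -- Membership in the cone depends on real parts only, so both `f` and `-f` lie in it.
  have hzero : ∀ f : lp (fun _ : Z => ℂ) ∞, (∀ z, (f z).re = 0) → t f = 0 := fun f h0 => by
    have h1 := htpos _ (mem_eigenCone_of_nonneg hf r fun z => (h0 z).ge)
    have h2 := htpos (-f) (mem_eigenCone_of_nonneg hf r fun z => by simp [h0 z])
    rw [map_neg] at h2
    linarith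
  have hbound : ∀ f, |t f| ≤ ‖f‖ := fun f => by
    have hn : ∀ z, |(f z).re| ≤ ‖f‖ := fun z =>
      (Complex.abs_re_le_norm _).trans (lp.norm_apply_le_norm (by simp) f z)
    have hval : ∀ (c : ℝ) (z : Z), (c • (1 : lp (fun _ : Z => ℂ) ∞)) z = (c : ℂ) := fun c z => by
      simp [lp.infty_coeFn_one]
    have h1 := htpos (‖f‖ • 1 - f) (mem_eigenCone_of_nonneg hf r fun z => by
      rw [lp.coeFn_sub, Pi.sub_apply, hval]
      simpa using (abs_le.1 (hn z)).2)
    have h2 := htpos (‖f‖ • 1 + f) (mem_eigenCone_of_nonneg hf r fun z => by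
      rw [lp.coeFn_add, Pi.add_apply, hval]
      have := (abs_le.1 (hn z)).1
      simp only [Complex.add_re, Complex.ofReal_re]
      linarith)
    rw [map_sub, map_smul, ht1, smul_eq_mul, mul_one] at h1
    rw [map_add, map_smul, ht1, smul_eq_mul, mul_one] at h2
    exact abs_le.2 ⟨by linarith, by linarith⟩
  have heig : ∀ f g : lp (fun _ : Z => ℂ) ∞, (∀ z, g z = transfer hf f z) → t g = r * t f := by
    intro f g hg
    have hg' : ∀ z, (-g : lp (fun _ : Z => ℂ) ∞) z = transfer hf (-f : lp (fun _ : Z => ℂ) ∞) z :=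
      fun z => by
        rw [lp_infty_neg_apply, hg]
        exact (Finset.sum_neg_distrib _).symm
    -- The witness `f` cancels `r f - g` exactly, and `-f` cancels `g - r f`; positivity in both
    -- directions forces equality.
    have h1 := htpos (r • f - g) ⟨f, g, hg, fun z => by
      simp [lp_infty_sub_apply, lp_infty_real_smul_apply]⟩
    have h2 := htpos (g - r • f) ⟨-f, -g, hg', fun z => by
      simp only [lp_infty_sub_apply, lp_infty_neg_apply, lp_infty_real_smul_apply]
      simp
      linarith⟩
    rw [map_sub, map_smul, smul_eq_mul] at h1 h2
    linarith
  -- The complexification `f ↦ t f - i t(i f)`; its two terms account for the factor `2` in the norm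
  -- bound.
  refine ⟨t.extendRCLike, ?_, fun f h0 => ?_, fun f => ?_, fun f g hg => ?_⟩
  · rw [Module.Dual.extendRCLike_apply, ht1, hzero (RCLike.I • 1) fun z => by
      simp [lp.infty_coeFn_one]]
    simp
  · rw [Module.Dual.extendRCLike_apply, hzero (RCLike.I • f) fun z => by
      simp [← (Complex.nonneg_iff.1 (h0 z)).2]]
    have := htpos f (mem_eigenCone_of_nonneg hf r fun z => (Complex.nonneg_iff.1 (h0 z)).1)
    simpa using this
  · rw [Module.Dual.extendRCLike_apply, two_mul]
    refine (norm_sub_le _ _).trans (add_le_add ?_ ?_)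
    · simpa using hbound f
    · have := hbound ((RCLike.I : ℂ) • f)
      rw [norm_smul] at this
      simpa using this
  · have hI := heig ((RCLike.I : ℂ) • f) ((RCLike.I : ℂ) • g) fun z => by
      rw [lp_infty_smul_apply, hg, ← transfer_mul_left]
      rfl
    rw [Module.Dual.extendRCLike_apply, Module.Dual.extendRCLike_apply, heig f g hg, hI]
    change ((r * t f : ℝ) : ℂ) - Complex.I * ((r * t (Complex.I • f) : ℝ) : ℂ) =
      (r : ℂ) * ((t f : ℝ) - Complex.I * (t (Complex.I • f) : ℝ))
    push_cast
    ring

end Eigenstate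

/-! ### The representation on square-summable functions -/

section Representation

universe u

variable {Z : Type u} {p : Z → Z}

open Classical in
/-- The unit vector at a point. -/
noncomputable def pointVec (z : Z) : lp (fun _ : Z => ℂ) 2 := lp.single 2 z 1

theorem inner_pointVec (z : Z) (f : lp (fun _ : Z => ℂ) 2) : inner ℂ (pointVec z) f = f z := by
  classical
  rw [pointVec, lp.inner_single_left]
  simp

theorem norm_pointVec (z : Z) : ‖pointVec z‖ = 1 := by
  classical
  rw [pointVec, lp.norm_single (by simp), norm_one]

theorem fiberCard_one (hf : ∀ z, (p ⁻¹' {z}).Finite) (z : Z) :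
    fiberCard p 1 z = (hf z).toFinset.card := by
  simp [fiberCard_succ hf 0, fiberCard_zero]

/-- Each value `g z` occurs at most `|p^{-1}(z)| ≤ N` times. This makes composition with `p` bounded
on `ℓ²`. -/
theorem sum_comp_le (hf : ∀ z, (p ⁻¹' {z}).Finite) {N : ℕ} (hN : ∀ z, fiberCard p 1 z ≤ N)
    {g : Z → ℝ} (hg : ∀ z, 0 ≤ g z) {K : ℝ} (hK : ∀ s : Finset Z, ∑ z ∈ s, g z ≤ K)
    (s : Finset Z) : ∑ w ∈ s, g (p w) ≤ N * K := by
  classical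
  calc ∑ w ∈ s, g (p w) = ∑ z ∈ s.image p, ∑ w ∈ s with p w = z, g (p w) :=
        (Finset.sum_fiberwise_of_maps_to (fun w hw => Finset.mem_image_of_mem p hw) _).symm
    _ ≤ ∑ z ∈ s.image p, N * g z := by
        refine Finset.sum_le_sum fun z _ => ?_
        rw [Finset.sum_congr rfl fun w hw => congrArg g (Finset.mem_filter.1 hw).2,
          Finset.sum_const, nsmul_eq_mul]
        refine mul_le_mul_of_nonneg_right ?_ (hg z)
        have h1 : (s.filter fun w => p w = z).card ≤ (hf z).toFinset.card :=
          Finset.card_le_card fun w hw => by simpa using (Finset.mem_filter.1 hw).2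
        exact_mod_cast h1.trans ((fiberCard_one hf z).symm.trans_le (hN z))
    _ ≤ N * K := by
        rw [← Finset.mul_sum]
        exact mul_le_mul_of_nonneg_left (hK _) N.cast_nonneg

variable [TopologicalSpace Z] [CompactSpace Z]

theorem sum_norm_weightedComp_le (hf : ∀ z, (p ⁻¹' {z}).Finite) {N : ℕ}
    (hN : ∀ z, fiberCard p 1 z ≤ N) (x : C(Z, ℂ)) (f : lp (fun _ : Z => ℂ) 2) (s : Finset Z) :
    ∑ w ∈ s, ‖x w * f (p w)‖ ^ (2 : ℝ≥0∞).toReal ≤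
      (‖x‖ * Real.sqrt N * ‖f‖) ^ (2 : ℝ≥0∞).toReal := by
  have h2 : (2 : ℝ≥0∞).toReal = 2 := by simp
  have hK : ∀ s : Finset Z, ∑ z ∈ s, ‖f z‖ ^ 2 ≤ ‖f‖ ^ 2 := fun s => by
    have := lp.sum_rpow_le_norm_rpow (p := 2) (by simp) f s
    simpa [h2] using this
  have h1 := sum_comp_le hf hN (fun z => sq_nonneg ‖f z‖) hK s
  simp only [h2, Real.rpow_two]
  calc ∑ w ∈ s, ‖x w * f (p w)‖ ^ 2 ≤ ∑ w ∈ s, ‖x‖ ^ 2 * ‖f (p w)‖ ^ 2 := by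
        refine Finset.sum_le_sum fun w _ => ?_
        rw [norm_mul, mul_pow]
        gcongr
        exact x.norm_coe_le_norm w
    _ ≤ ‖x‖ ^ 2 * (N * ‖f‖ ^ 2) := by
        rw [← Finset.mul_sum]
        gcongr
    _ = _ := by
        rw [mul_pow, mul_pow, Real.sq_sqrt N.cast_nonneg]
        ring

/-- The weighted composition operator `f ↦ x · (f ∘ p)` on square-summable functions. -/
noncomputable def weightedComp (hf : ∀ z, (p ⁻¹' {z}).Finite)
    (hb : BddAbove (Set.range (fiberCard p 1))) (x : C(Z, ℂ)) :
    lp (fun _ : Z => ℂ) 2 →L[ℂ] lp (fun _ : Z => ℂ) 2 :=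
  have hN : ∀ z, fiberCard p 1 z ≤ hb.some := fun z => hb.some_mem ⟨z, rfl⟩
  LinearMap.mkContinuous
    { toFun := fun f => ⟨fun w => x w * f (p w), memℓp_gen' (sum_norm_weightedComp_le hf hN x f)⟩
      map_add' := fun f g => by
        ext w
        exact mul_add (x w) (f (p w)) (g (p w))
      map_smul' := fun c f => by
        ext w
        exact mul_left_comm (x w) c (f (p w)) }
    (‖x‖ * Real.sqrt hb.some)
    fun f => lp.norm_le_of_forall_sum_le (by simp) (by positivity)
      (sum_norm_weightedComp_le hf hN x f)

theorem weightedComp_apply (hf : ∀ z, (p ⁻¹' {z}).Finite)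
    (hb : BddAbove (Set.range (fiberCard p 1))) (x : C(Z, ℂ)) (f : lp (fun _ : Z => ℂ) 2) (w : Z) :
    weightedComp hf hb x f w = x w * f (p w) := rfl

theorem weightedComp_pointVec (hf : ∀ z, (p ⁻¹' {z}).Finite)
    (hb : BddAbove (Set.range (fiberCard p 1))) (x : C(Z, ℂ)) (z : Z) :
    weightedComp hf hb x (pointVec z) = ∑ w ∈ (hf z).toFinset, x w • pointVec w := by
  classical
  ext v
  rw [weightedComp_apply, lp.coeFn_sum, Finset.sum_apply]
  have hv : ∀ w v : Z, (pointVec w) v = if v = w then 1 else 0 := fun w v => by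
    simp [pointVec, lp.single_apply, Pi.single_apply]
  have hs : ∀ w : Z, (x w • pointVec w : lp (fun _ : Z => ℂ) 2) v = if v = w then x w else 0 :=
    fun w => by
      rw [lp.coeFn_smul, Pi.smul_apply, hv]
      simp
  simp only [hs, hv]
  rw [Finset.sum_ite_eq]
  simp

theorem adjoint_weightedComp_apply (hf : ∀ z, (p ⁻¹' {z}).Finite)
    (hb : BddAbove (Set.range (fiberCard p 1))) (x : C(Z, ℂ)) (f : lp (fun _ : Z => ℂ) 2) (z : Z) :
    (star (weightedComp hf hb x)) f z = ∑ w ∈ (hf z).toFinset, conj (x w) * f w := by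
  rw [← inner_pointVec, ContinuousLinearMap.star_eq_adjoint,
    ContinuousLinearMap.adjoint_inner_right, weightedComp_pointVec, sum_inner]
  simp_rw [inner_smul_left, inner_pointVec]

end Representation

/-! ### The covariant representation of the bimodule on `ℓ²(Z)` -/

section PointRep

universe u

theorem finite_fiber_id {Z : Type u} (z : Z) : (id ⁻¹' {z} : Set Z).Finite := by simp

theorem bddAbove_fiberCard_id {Z : Type u} : BddAbove (Set.range (fiberCard (id : Z → Z) 1)) :=
  ⟨1, by rintro _ ⟨z, rfl⟩; simp [fiberCard]⟩

variable {Z : Type u} [TopologicalSpace Z] [CompactSpace Z] [T2Space Z] {h : Z → Z}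

theorem fiberSum_apply (hh : IsLocalHomeomorph h) (f : C(Z, ℂ)) (z : Z) :
    fiberSum hh f z = transfer hh.finite_fiber f z := by
  change ∑ᶠ w : h ⁻¹' {z}, f w = _
  rw [finsum_set_coe_eq_finsum_mem (f := fun w => f w),
    finsum_mem_eq_finite_toFinset_sum _ (hh.finite_fiber z)]
  rfl

/-- The fibre count is the fibre sum of the constant `1`, a continuous function on a compact space.
-/
theorem IsLocalHomeomorph.bddAbove_fiberCard_one (hh : IsLocalHomeomorph h) :
    BddAbove (Set.range (fiberCard h 1)) := by
  refine ⟨⌊‖fiberSum hh 1‖⌋₊, ?_⟩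
  rintro _ ⟨z, rfl⟩
  refine Nat.le_floor ?_
  have h1 : fiberSum hh 1 z = (fiberCard h 1 z : ℂ) := by
    simp [fiberSum_apply, transfer, fiberCard_one hh.finite_fiber]
  have h2 := (fiberSum hh 1).norm_coe_le_norm z
  rwa [h1, Complex.norm_natCast] at h2

/-- Multiplication operators on square-summable functions. -/
noncomputable def mulRep (Z : Type u) [TopologicalSpace Z] [CompactSpace Z] [T2Space Z] :
    C(Z, ℂ) →⋆ₐ[ℂ] (lp (fun _ : Z => ℂ) 2 →L[ℂ] lp (fun _ : Z => ℂ) 2) where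
  toFun a := weightedComp finite_fiber_id bddAbove_fiberCard_id a
  map_one' := by
    ext f w
    exact one_mul (f w)
  map_mul' a b := by
    ext f w
    exact mul_assoc (a w) (b w) (f w)
  map_zero' := by
    ext f w
    exact zero_mul (f w)
  map_add' a b := by
    ext f w
    exact add_mul (a w) (b w) (f w)
  commutes' c := by
    ext f w
    rfl
  map_star' a := by
    ext f w
    rw [adjoint_weightedComp_apply, weightedComp_apply]
    simp

theorem mulRep_apply (a : C(Z, ℂ)) (f : lp (fun _ : Z => ℂ) 2) (w : Z) :
    mulRep Z a f w = a w * f w := rfl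

/-- The operators `f ↦ x · (f ∘ h)` on square-summable functions. -/
noncomputable def creationRep (hh : IsLocalHomeomorph h) :
    C(Z, ℂ) →ₗ[ℂ] (lp (fun _ : Z => ℂ) 2 →L[ℂ] lp (fun _ : Z => ℂ) 2) where
  toFun x := weightedComp hh.finite_fiber hh.bddAbove_fiberCard_one x
  map_add' x y := by
    ext f w
    exact add_mul (x w) (y w) (f (h w))
  map_smul' c x := by
    ext f w
    exact mul_assoc c (x w) (f (h w))

theorem creationRep_apply (hh : IsLocalHomeomorph h) (x : C(Z, ℂ)) (f : lp (fun _ : Z => ℂ) 2)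
    (w : Z) : creationRep hh x f w = x w * f (h w) := rfl

theorem star_creationRep_apply (hh : IsLocalHomeomorph h) (x : C(Z, ℂ))
    (f : lp (fun _ : Z => ℂ) 2) (z : Z) :
    star (creationRep hh x) f z = transfer hh.finite_fiber (fun w => conj (x w) * f w) z :=
  adjoint_weightedComp_apply hh.finite_fiber hh.bddAbove_fiberCard_one x f z

theorem bimoduleInner_apply (hh : IsLocalHomeomorph h) (x y : C(Z, ℂ)) (z : Z) :
    bimoduleInner hh x y z = transfer hh.finite_fiber (fun w => conj (x w) * y w) z :=
  fiberSum_apply hh _ z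

theorem exists_continuousMap_eqOn_finite {F : Set Z} (hF : F.Finite) (f : Z → ℂ) :
    ∃ g : C(Z, ℂ), ∀ w ∈ F, g w = f w := by
  have := hF.to_subtype
  obtain ⟨g, hg⟩ := ContinuousMap.exists_restrict_eq hF.isClosed
    (⟨fun w => f w, continuous_of_discreteTopology⟩ : C(F, ℂ))
  exact ⟨g, fun w hw => congrArg (fun k : C(F, ℂ) => k ⟨w, hw⟩) hg⟩

/-- The covariant representation of `X` on square-summable functions on `Z`. -/
noncomputable def pointRep [Nonempty Z] (hh : IsLocalHomeomorph h) : CovariantRep hh where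
  alg := lp (fun _ : Z => ℂ) 2 →L[ℂ] lp (fun _ : Z => ℂ) 2
  nontriv := by
    have : Nontrivial (lp (fun _ : Z => ℂ) 2) :=
      ⟨pointVec (Classical.arbitrary Z), 0, fun h0 => by
        simpa [h0] using norm_pointVec (Classical.arbitrary Z)⟩
    infer_instance
  π := mulRep Z
  ψ := creationRep hh
  left a x := by
    ext f w
    exact mul_assoc (a w) (x w) (f (h w))
  right x b := by
    ext f w
    exact mul_assoc (x w) (b (h w)) (f (h w))
  inner x y := by
    ext f z
    rw [mulRep_apply, bimoduleInner_apply, mul_apply_eq_comp, star_creationRep_apply,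
      transfer, transfer, Finset.sum_mul]
    refine Finset.sum_congr rfl fun w hw => ?_
    have hwz : h w = z := by simpa using hw
    rw [creationRep_apply, hwz, mul_assoc]
  covariant a n x y H := by
    ext f w
    -- The hypothesis concerns continuous functions, whereas `f` is arbitrary in `ℓ²`. At `w`, both
    -- sides involve `f` only on the finite fibre through `w`, where a continuous `g` interpolates
    -- it.
    obtain ⟨g, hg⟩ := exists_continuousMap_eqOn_finite (hh.finite_fiber (h w)) f
    have h1 := congrArg (fun k : C(Z, ℂ) => k w) (H g)
    have h2 : (∑ i, creationRep hh (x i) * star (creationRep hh (y i))) f w =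
        ∑ i, (creationRep hh (x i) * star (creationRep hh (y i))) f w := by
      rw [sum_apply, lp.coeFn_sum, Finset.sum_apply]
    rw [h2, mulRep_apply, ← hg w rfl]
    simp only [ContinuousMap.mul_apply, ContinuousMap.sum_apply] at h1
    rw [h1]
    refine Finset.sum_congr rfl fun i _ => ?_
    rw [mul_apply_eq_comp, creationRep_apply, star_creationRep_apply]
    change x i w * bimoduleInner hh (y i) g (h w) = _
    rw [bimoduleInner_apply]
    congr 1
    refine Finset.sum_congr rfl fun v hv => ?_
    exact congrArg (conj (y i v) * ·) (hg v (by simpa using hv))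

end PointRep

/-! ### A criterion for KMS states of periodic dynamics -/

section Criterion

variable {A : Type*} [CStarAlgebra A]

/-- The identity theorem: the real points accumulate at `0`. -/
theorem eq_of_differentiable_of_eq_ofReal {f g : ℂ → ℂ} (hf : Differentiable ℂ f)
    (hg : Differentiable ℂ g) (H : ∀ t : ℝ, f t = g t) : f = g := by
  have han : ∀ k : ℂ → ℂ, Differentiable ℂ k → AnalyticOnNhd ℂ k Set.univ := fun k hk =>
    hk.differentiableOn.analyticOnNhd isOpen_univ
  refine (han f hf).eq_of_frequently_eq (z₀ := 0) (han g hg) ?_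
  have ht : Tendsto (fun t : ℝ => (t : ℂ)) (𝓝[≠] 0) (𝓝[≠] 0) := by
    refine tendsto_nhdsWithin_iff.2 ⟨?_, ?_⟩
    · have := Complex.continuous_ofReal.tendsto 0
      rw [Complex.ofReal_zero] at this
      exact this.mono_left nhdsWithin_le_nhds
    · filter_upwards [self_mem_nhdsWithin] with t ht
      simpa using ht
  exact ht.frequently (Frequently.of_forall H)

/-- An invariant state satisfying the KMS condition against homogeneous elements spanning a dense
subspace is a KMS state. -/
theorem isKMSState_of_homogeneous {α : ℝ → (A ≃⋆ₐ[ℂ] A)} {β : ℝ} (φ : A →L[ℂ] ℂ)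
    (hφ : IsState (φ : A →ₗ[ℂ] ℂ)) (hinv : ∀ t b, φ (α t b) = φ b) {D : Set A}
    (hD : Dense (Submodule.span ℂ D : Set A))
    (H : ∀ b ∈ D, ∃ n : ℤ, (∀ t : ℝ, α t b = Complex.exp (Complex.I * n * t) • b) ∧
      ∀ a, φ (a * b) = Complex.exp (n * β) * φ (b * a)) :
    IsKMSState α β (φ : A →ₗ[ℂ] ℂ) := by
  refine ⟨hφ, fun a b F hF hFα => ?_⟩
  suffices h : φ.comp (ContinuousLinearMap.mul ℂ A a) =
      φ.comp ((ContinuousLinearMap.mul ℂ A).flip (F (Complex.I * β))) from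
    congrArg (fun k : A →L[ℂ] ℂ => k b) h
  refine ContinuousLinearMap.ext_on hD fun b hb => ?_
  obtain ⟨n, hn, hnβ⟩ := H b hb
  change φ (a * b) = φ (b * F (Complex.I * β))
  -- Invariance gives `φ(b α_t(a)) = e^{-int} φ(b a)` for real `t`, and both sides are entire. At `z
  -- = iβ` the factor becomes `e^{nβ}`.
  have h1 : (fun z => φ (b * F z)) = fun z => Complex.exp (-(Complex.I * n * z)) * φ (b * a) := by
    refine eq_of_differentiable_of_eq_ofReal ?_ (by fun_prop) fun t => ?_
    · exact φ.differentiable.comp (((ContinuousLinearMap.mul ℂ A) b).differentiable.comp hF)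
    · have h2 := hinv t (b * a)
      rw [map_mul, hn, smul_mul_assoc, map_smul, smul_eq_mul, ← hFα] at h2
      rw [← h2, ← mul_assoc, ← Complex.exp_add, neg_add_cancel, Complex.exp_zero, one_mul]
  rw [hnβ, congrFun h1 (Complex.I * β)]
  congr 2
  linear_combination ((n : ℂ) * β) * Complex.I_mul_I

/-- Strong continuity follows from continuity on a set spanning a dense subspace. -/
theorem continuous_orbit_of_dense {α : ℝ → (A ≃⋆ₐ[ℂ] A)} {D : Set A}
    (hD : Dense (Submodule.span ℂ D : Set A)) (H : ∀ b ∈ D, Continuous fun t => α t b) (b : A) :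
    Continuous fun t => α t b := by
  have hspan : ∀ b ∈ Submodule.span ℂ D, Continuous fun t => α t b := fun b hb => by
    induction hb using Submodule.span_induction with
    | mem b hb => exact H b hb
    | zero => simpa using continuous_const
    | add b c _ _ hb hc =>
      simp only [map_add]
      exact hb.add hc
    | smul c b _ hb =>
      simp only [map_smul]
      exact hb.const_smul c
  refine continuous_of_uniform_approx_of_continuous fun u hu => ?_
  obtain ⟨ε, hε, hεu⟩ := Metric.mem_uniformity_dist.1 hu
  obtain ⟨c, hc, hbc⟩ := hD.exists_dist_lt b hε
  refine ⟨fun t => α t c, hspan c hc, fun t => hεu ?_⟩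
  rw [dist_eq_norm, ← map_sub]
  rw [dist_eq_norm] at hbc
  exact (NonUnitalStarAlgHom.norm_apply_le (α t) (b - c)).trans_lt hbc

/-- Averaging a state over a periodic dynamics. -/
theorem exists_invariant_average {α : ℝ → (A ≃⋆ₐ[ℂ] A)}
    (hadd : ∀ s t b, α (s + t) b = α s (α t b))
    (hper : ∀ t b, α (t + 2 * Real.pi) b = α t b) (hcont : ∀ b, Continuous fun t => α t b)
    (φ₀ : A →L[ℂ] ℂ) (hφ₀ : IsState (φ₀ : A →ₗ[ℂ] ℂ)) :
    ∃ φ : A →L[ℂ] ℂ, IsState (φ : A →ₗ[ℂ] ℂ) ∧ (∀ t b, φ (α t b) = φ b) ∧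
      ∀ (b : A) (n : ℤ) (c : ℂ), (∀ t : ℝ, α t b = Complex.exp (Complex.I * n * t) • b) →
        (∀ a, φ₀ (a * b) = c * φ₀ (b * a)) → ∀ a, φ (a * b) = c * φ (b * a) := by
  have hc : ∀ b, Continuous fun t => φ₀ (α t b) := fun b => φ₀.continuous.comp (hcont b)
  have hi : ∀ b x y, IntervalIntegrable (fun t => φ₀ (α t b)) MeasureTheory.volume x y :=
    fun b x y => (hc b).intervalIntegrable x y
  have hπ : (0 : ℝ) < 2 * Real.pi := by positivity
  let φ' : A →ₗ[ℂ] ℂ :=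
    { toFun := fun b => ((2 * Real.pi)⁻¹ : ℝ) * ∫ t in (0 : ℝ)..2 * Real.pi, φ₀ (α t b)
      map_add' := fun b c => by
        simp only [map_add]
        rw [intervalIntegral.integral_add (hi b _ _) (hi c _ _), mul_add]
      map_smul' := fun c b => by
        simp only [map_smul, smul_eq_mul, RingHom.id_apply]
        rw [intervalIntegral.integral_const_mul]
        ring }
  have hbound : ∀ b, ‖φ' b‖ ≤ ‖φ₀‖ * ‖b‖ := fun b => by
    have h1 : ‖∫ t in (0 : ℝ)..2 * Real.pi, φ₀ (α t b)‖ ≤ ‖φ₀‖ * ‖b‖ * |2 * Real.pi - 0| :=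
      intervalIntegral.norm_integral_le_of_norm_le_const fun t _ =>
        (φ₀.le_opNorm _).trans (mul_le_mul_of_nonneg_left
          (NonUnitalStarAlgHom.norm_apply_le (α t) b) (norm_nonneg _))
    rw [sub_zero, abs_of_pos hπ] at h1
    change ‖(((2 * Real.pi)⁻¹ : ℝ) : ℂ) * ∫ t in (0 : ℝ)..2 * Real.pi, φ₀ (α t b)‖ ≤ _
    rw [norm_mul, Complex.norm_real, Real.norm_of_nonneg (by positivity), inv_mul_le_iff₀ hπ]
    linarith
  refine ⟨φ'.mkContinuous _ hbound, ⟨?_, fun a => ?_⟩, fun s b => ?_, fun b n c hb hc' a => ?_⟩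
  · change (((2 * Real.pi)⁻¹ : ℝ) : ℂ) * ∫ t in (0 : ℝ)..2 * Real.pi, φ₀ (α t 1) = 1
    have h1 : φ₀ 1 = 1 := hφ₀.map_one
    simp only [map_one, h1, intervalIntegral.integral_const, sub_zero]
    rw [Complex.real_smul, mul_one, ← Complex.ofReal_mul, inv_mul_cancel₀ hπ.ne',
      Complex.ofReal_one]
  · change 0 ≤ (((2 * Real.pi)⁻¹ : ℝ) : ℂ) * ∫ t in (0 : ℝ)..2 * Real.pi, φ₀ (α t (star a * a))
    refine mul_nonneg (by exact_mod_cast (by positivity : 0 ≤ (2 * Real.pi)⁻¹)) ?_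
    rw [intervalIntegral.integral_of_le hπ.le]
    refine MeasureTheory.integral_nonneg fun t => ?_
    change 0 ≤ φ₀ (α t (star a * a))
    rw [map_mul, map_star]
    exact hφ₀.nonneg _
  · change (((2 * Real.pi)⁻¹ : ℝ) : ℂ) * ∫ t in (0 : ℝ)..2 * Real.pi, φ₀ (α t (α s b)) =
      (((2 * Real.pi)⁻¹ : ℝ) : ℂ) * ∫ t in (0 : ℝ)..2 * Real.pi, φ₀ (α t b)
    simp only [← hadd]
    rw [intervalIntegral.integral_comp_add_right (fun t => φ₀ (α t b)), zero_add, add_comm _ s]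
    have hp : Function.Periodic (fun t => φ₀ (α t b)) (2 * Real.pi) := fun t => by
      simp only [hper]
    rw [hp.intervalIntegral_add_eq s 0, zero_add]
  · change (((2 * Real.pi)⁻¹ : ℝ) : ℂ) * ∫ t in (0 : ℝ)..2 * Real.pi, φ₀ (α t (a * b)) =
      c * ((((2 * Real.pi)⁻¹ : ℝ) : ℂ) * ∫ t in (0 : ℝ)..2 * Real.pi, φ₀ (α t (b * a)))
    rw [mul_left_comm c]
    congr 1
    rw [← intervalIntegral.integral_const_mul]
    congr 1
    funext t
    -- The phase `e^{int}` comes out of both products, so the relation for `φ₀` applies pointwise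
    -- with `α t a` in place of `a`.
    rw [map_mul (α t), map_mul (α t), hb, mul_smul_comm, smul_mul_assoc, map_smul, map_smul, hc',
      smul_eq_mul, smul_eq_mul]
    ring

end Criterion

/-! ### KMS states from eigenstates of the transfer operator -/

section Existence

universe u

variable {Z : Type u}

/-- The diagonal of an operator on square-summable functions. -/
noncomputable def diagonal (Z : Type u) :
    (lp (fun _ : Z => ℂ) 2 →L[ℂ] lp (fun _ : Z => ℂ) 2) →ₗ[ℂ] lp (fun _ : Z => ℂ) ∞ where
  toFun T := ⟨fun z => T (pointVec z) z, memℓp_infty ⟨‖T‖, by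
    rintro _ ⟨z, rfl⟩
    refine (lp.norm_apply_le_norm (by simp) (T (pointVec z)) z).trans ?_
    simpa [norm_pointVec] using T.le_opNorm (pointVec z)⟩⟩
  map_add' _ _ := rfl
  map_smul' _ _ := rfl

theorem diagonal_apply (T : lp (fun _ : Z => ℂ) 2 →L[ℂ] lp (fun _ : Z => ℂ) 2) (z : Z) :
    diagonal Z T z = T (pointVec z) z := rfl

theorem norm_diagonal_le (T : lp (fun _ : Z => ℂ) 2 →L[ℂ] lp (fun _ : Z => ℂ) 2) :
    ‖diagonal Z T‖ ≤ ‖T‖ :=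
  lp.norm_le_of_forall_le (norm_nonneg _) fun z => by
    refine (lp.norm_apply_le_norm (by simp) (T (pointVec z)) z).trans ?_
    simpa [norm_pointVec] using T.le_opNorm (pointVec z)

theorem diagonal_star_mul_self_nonneg
    (T : lp (fun _ : Z => ℂ) 2 →L[ℂ] lp (fun _ : Z => ℂ) 2) (z : Z) :
    0 ≤ diagonal Z (star T * T) z := by
  rw [diagonal_apply, ← inner_pointVec, mul_apply_eq_comp, ContinuousLinearMap.star_eq_adjoint,
    ContinuousLinearMap.adjoint_inner_right, inner_self_eq_norm_sq_to_K]
  exact pow_nonneg (Complex.zero_le_real.2 (norm_nonneg (T (pointVec z)))) 2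

theorem pointVec_apply [DecidableEq Z] (z w : Z) : pointVec z w = if w = z then 1 else 0 := by
  simp only [pointVec, lp.single_apply, Pi.single_apply]
  congr

variable [TopologicalSpace Z] [CompactSpace Z] [T2Space Z] {h : Z → Z}

namespace CuntzPimsner

/-- Evaluation of an element of `O(X)` in a covariant representation. -/
noncomputable def evalRep {hh : IsLocalHomeomorph h} (R : CovariantRep hh) :
    CuntzPimsner hh →⋆ₐ[ℂ] R.alg where
  toFun b := b.1 R
  map_one' := rfl
  map_mul' _ _ := rfl
  map_zero' := rfl
  map_add' _ _ := rfl
  commutes' _ := rfl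
  map_star' _ := rfl

theorem ext_evalRep {hh : IsLocalHomeomorph h} {a b : CuntzPimsner hh}
    (H : ∀ R : CovariantRep hh, evalRep R a = evalRep R b) : a = b :=
  Subtype.ext (lp.ext (funext H))

/-- A set containing the generators and closed under products spans a dense subspace of `O(X)`. -/
theorem dense_span (hh : IsLocalHomeomorph h) {D : Set (CuntzPimsner hh)} (h1 : 1 ∈ D)
    (hmul : ∀ a ∈ D, ∀ b ∈ D, a * b ∈ D) (hπ : ∀ a, π hh a ∈ D) (hψ : ∀ x, ψ hh x ∈ D)
    (hψ' : ∀ x, star (ψ hh x) ∈ D) :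
    Dense (Submodule.span ℂ D : Set (CuntzPimsner hh)) := by
  set G : Set (RepProduct hh) := Set.range (RepProduct.π hh) ∪ Set.range (RepProduct.ψ hh)
  -- The adjoin is the span of the words in the generators and their adjoints, and `D` contains all
  -- these words.
  have hword : ∀ b ∈ Submonoid.closure (G ∪ star G), ∃ c ∈ D, (c : RepProduct hh) = b := by
    intro b hb
    induction hb using Submonoid.closure_induction with
    | mem b hb =>
      rcases hb with (⟨a, rfl⟩ | ⟨x, rfl⟩) | (⟨a, ha⟩ | ⟨x, hx⟩)
      · exact ⟨_, hπ a, rfl⟩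
      · exact ⟨_, hψ x, rfl⟩
      · refine ⟨_, hπ (star a), ?_⟩
        rw [← star_star b, ← ha]
        refine lp.ext (funext fun R => ?_)
        exact map_star R.π a
      · refine ⟨_, hψ' x, ?_⟩
        rw [← star_star b, ← hx]
        rfl
    | one => exact ⟨1, h1, rfl⟩
    | mul b c _ _ hb hc =>
      obtain ⟨b', hb', rfl⟩ := hb
      obtain ⟨c', hc', rfl⟩ := hc
      exact ⟨b' * c', hmul _ hb' _ hc', rfl⟩
  have hspan : ∀ b ∈ Submodule.span ℂ (Submonoid.closure (G ∪ star G) : Set (RepProduct hh)),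
      b ∈ Subtype.val '' (Submodule.span ℂ D : Set (CuntzPimsner hh)) := by
    intro b hb
    induction hb using Submodule.span_induction with
    | mem b hb =>
      obtain ⟨c, hc, rfl⟩ := hword b hb
      exact ⟨c, Submodule.subset_span hc, rfl⟩
    | zero => exact ⟨0, Submodule.zero_mem _, rfl⟩
    | add b c _ _ hb hc =>
      obtain ⟨b', hb', rfl⟩ := hb
      obtain ⟨c', hc', rfl⟩ := hc
      exact ⟨b' + c', Submodule.add_mem _ hb' hc', rfl⟩
    | smul c b _ hb =>
      obtain ⟨b', hb', rfl⟩ := hb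
      exact ⟨c • b', Submodule.smul_mem _ c hb', rfl⟩
  have hadj : ∀ b ∈ StarAlgebra.adjoin ℂ G,
      b ∈ Subtype.val '' (Submodule.span ℂ D : Set (CuntzPimsner hh)) := fun b hb =>
    hspan b (by rw [← StarAlgebra.adjoin_eq_span]; exact hb)
  intro b
  rw [closure_subtype]
  exact closure_mono hadj b.2

theorem dynamics_add (hh : IsLocalHomeomorph h) (s t : ℝ) (b : CuntzPimsner hh) :
    dynamics hh (s + t) b = dynamics hh s (dynamics hh t b) := by
  change gaugeHom hh (Circle.exp (s + t)) b =
    gaugeHom hh (Circle.exp s) (gaugeHom hh (Circle.exp t) b)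
  rw [gaugeHom_comp, Circle.exp_add]

theorem dynamics_add_two_pi (hh : IsLocalHomeomorph h) (t : ℝ) (b : CuntzPimsner hh) :
    dynamics hh (t + 2 * Real.pi) b = dynamics hh t b := by
  rw [dynamics, dynamics, Circle.exp_add_two_pi]

theorem dynamics_π (hh : IsLocalHomeomorph h) (t : ℝ) (a : C(Z, ℂ)) :
    dynamics hh t (π hh a) = π hh a := rfl

theorem dynamics_ψ (hh : IsLocalHomeomorph h) (t : ℝ) (x : C(Z, ℂ)) :
    dynamics hh t (ψ hh x) = Complex.exp (Complex.I * t) • ψ hh x := by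
  rw [dynamics, gauge_ψ, Circle.coe_exp, mul_comm]

theorem dynamics_star_ψ (hh : IsLocalHomeomorph h) (t : ℝ) (x : C(Z, ℂ)) :
    dynamics hh t (star (ψ hh x)) = Complex.exp (-(Complex.I * t)) • star (ψ hh x) := by
  rw [map_star, dynamics_ψ, star_smul, Complex.star_def, ← Complex.exp_conj]
  simp

theorem mulRep_pointVec (a : C(Z, ℂ)) (z : Z) : mulRep Z a (pointVec z) = a z • pointVec z := by
  classical
  ext w
  rw [mulRep_apply, lp.coeFn_smul, Pi.smul_apply, pointVec_apply, smul_eq_mul]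
  split_ifs with hw
  · rw [hw]
  · simp

theorem creationRep_pointVec (hh : IsLocalHomeomorph h) (x : C(Z, ℂ)) (z : Z) :
    creationRep hh x (pointVec z) = ∑ w ∈ (hh.finite_fiber z).toFinset, x w • pointVec w :=
  weightedComp_pointVec hh.finite_fiber hh.bddAbove_fiberCard_one x z

theorem star_creationRep_pointVec (hh : IsLocalHomeomorph h) (x : C(Z, ℂ)) (w : Z) :
    star (creationRep hh x) (pointVec w) = conj (x w) • pointVec (h w) := by
  classical
  ext z
  rw [star_creationRep_apply, lp.coeFn_smul, Pi.smul_apply, pointVec_apply, transfer]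
  simp only [pointVec_apply, mul_ite, mul_one, mul_zero, smul_eq_mul]
  rw [Finset.sum_ite_eq']
  simp [eq_comm]

theorem diagonal_mul_mulRep (T : lp (fun _ : Z => ℂ) 2 →L[ℂ] lp (fun _ : Z => ℂ) 2)
    (a : C(Z, ℂ)) : diagonal Z (T * mulRep Z a) = diagonal Z (mulRep Z a * T) := by
  ext z
  rw [diagonal_apply, diagonal_apply, mul_apply_eq_comp, mul_apply_eq_comp, mulRep_pointVec,
    map_smul, mulRep_apply]
  rfl

/-- Both sides are sums over `h(w) = z` of `x(w)` times the `(z, w)` matrix entry of `T`. Thus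
commuting a creation operator past `T` costs one application of `L` on diagonals, and `τ` turns it
into the factor `e^β`. -/
theorem diagonal_mul_creationRep (hh : IsLocalHomeomorph h)
    (T : lp (fun _ : Z => ℂ) 2 →L[ℂ] lp (fun _ : Z => ℂ) 2) (x : C(Z, ℂ)) (z : Z) :
    diagonal Z (T * creationRep hh x) z =
      transfer hh.finite_fiber (diagonal Z (creationRep hh x * T)) z := by
  rw [diagonal_apply, mul_apply_eq_comp, creationRep_pointVec, map_sum, lp.coeFn_sum,
    Finset.sum_apply]
  refine Finset.sum_congr rfl fun w hw => ?_
  have hwz : h w = z := by simpa using hw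
  rw [diagonal_apply, mul_apply_eq_comp, creationRep_apply, map_smul, hwz]
  rfl

theorem diagonal_star_creationRep_mul (hh : IsLocalHomeomorph h)
    (T : lp (fun _ : Z => ℂ) 2 →L[ℂ] lp (fun _ : Z => ℂ) 2) (x : C(Z, ℂ)) (z : Z) :
    diagonal Z (star (creationRep hh x) * T) z =
      transfer hh.finite_fiber (diagonal Z (T * star (creationRep hh x))) z := by
  rw [diagonal_apply, mul_apply_eq_comp, star_creationRep_apply]
  refine Finset.sum_congr rfl fun w hw => ?_
  have hwz : h w = z := by simpa using hw
  rw [diagonal_apply, mul_apply_eq_comp, star_creationRep_pointVec, map_smul, hwz]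
  rfl

/-- An eigenstate of the transfer operator at `e^β` gives a KMS state at `β`. -/
theorem mem_inverseTemperatures_of_eigenstate [Nonempty Z] (hh : IsLocalHomeomorph h) {β : ℝ}
    (τ : lp (fun _ : Z => ℂ) ∞ →ₗ[ℂ] ℂ) (hτ1 : τ 1 = 1)
    (hτpos : ∀ f, (∀ z, 0 ≤ f z) → 0 ≤ τ f) (hτb : ∀ f, ‖τ f‖ ≤ 2 * ‖f‖)
    (hτ : ∀ f g : lp (fun _ : Z => ℂ) ∞, (∀ z, g z = transfer hh.finite_fiber f z) →
      τ g = Real.exp β * τ f) :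
    β ∈ inverseTemperatures hh := by
  let ρ : CuntzPimsner hh →⋆ₐ[ℂ] (lp (fun _ : Z => ℂ) 2 →L[ℂ] lp (fun _ : Z => ℂ) 2) :=
    evalRep (pointRep hh)
  have hρπ : ∀ a, ρ (π hh a) = mulRep Z a := fun _ => rfl
  have hρψ : ∀ x, ρ (ψ hh x) = creationRep hh x := fun _ => rfl
  let φ₀ : CuntzPimsner hh →L[ℂ] ℂ :=
    (τ ∘ₗ diagonal Z ∘ₗ ρ.toAlgHom.toLinearMap).mkContinuous 2 fun b =>
      (hτb _).trans (mul_le_mul_of_nonneg_left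
        ((norm_diagonal_le _).trans (NonUnitalStarAlgHom.norm_apply_le ρ b)) zero_le_two)
  have hφ₀ : ∀ b, φ₀ b = τ (diagonal Z (ρ b)) := fun _ => rfl
  have hstate : IsState (φ₀ : CuntzPimsner hh →ₗ[ℂ] ℂ) := by
    refine ⟨?_, fun a => ?_⟩
    · change τ (diagonal Z (ρ 1)) = 1
      rw [map_one, ← hτ1]
      congr 1
      classical
      ext z
      rw [diagonal_apply, one_apply_eq_self, pointVec_apply, if_pos rfl]
      rfl
    · change 0 ≤ τ (diagonal Z (ρ (star a * a)))
      rw [map_mul, map_star]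
      exact hτpos _ (diagonal_star_mul_self_nonneg _)
  -- Homogeneous elements of weight `n` with their KMS relation. Weights add under products, so only
  -- the generators need checking: weight `0` for `π`, `1` for `ψ`, `-1` for `ψ*`.
  let D : Set (CuntzPimsner hh) := {b | ∃ n : ℤ,
    (∀ t : ℝ, dynamics hh t b = Complex.exp (Complex.I * n * t) • b) ∧
      ∀ a, φ₀ (a * b) = Complex.exp (n * β) * φ₀ (b * a)}
  have hD : Dense (Submodule.span ℂ D : Set (CuntzPimsner hh)) := by
    refine dense_span hh ⟨0, fun t => by simp, fun a => by simp⟩ ?_ (fun a => ?_) (fun x => ?_)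
      (fun x => ?_)
    · rintro b ⟨n, hn, hnβ⟩ c ⟨m, hm, hmβ⟩
      refine ⟨n + m, fun t => ?_, fun a => ?_⟩
      · rw [map_mul, hn, hm, smul_mul_smul_comm, ← Complex.exp_add]
        congr 2
        push_cast
        ring
      · rw [← mul_assoc, hmβ, ← mul_assoc, hnβ, ← mul_assoc, ← Complex.exp_add, mul_assoc b]
        congr 2
        push_cast
        ring
    · refine ⟨0, fun t => by simp [dynamics_π], fun b => ?_⟩
      rw [hφ₀, hφ₀, map_mul ρ, map_mul ρ, hρπ, diagonal_mul_mulRep]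
      simp
    · refine ⟨1, fun t => by simp [dynamics_ψ], fun b => ?_⟩
      rw [hφ₀, hφ₀, map_mul ρ, map_mul ρ, hρψ, hτ _ _ (diagonal_mul_creationRep hh (ρ b) x)]
      simp
    · refine ⟨-1, fun t => by simp [dynamics_star_ψ], fun b => ?_⟩
      rw [hφ₀, hφ₀, map_mul ρ, map_mul ρ, map_star, hρψ,
        hτ _ _ (diagonal_star_creationRep_mul hh (ρ b) x), ← mul_assoc, Complex.ofReal_exp,
        ← Complex.exp_add]
      simp
  have hcont : ∀ b, Continuous fun t => dynamics hh t b :=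
    continuous_orbit_of_dense hD fun b ⟨n, hn, _⟩ => by
      simp only [hn]
      fun_prop
  -- The relations for `φ₀` do not give invariance when `β = 0`: periodic points can contribute to
  -- diagonals of elements of nonzero weight. Averaging supplies invariance and keeps the relations.
  obtain ⟨φ, hφ, hinv, H⟩ := exists_invariant_average (dynamics_add hh) (dynamics_add_two_pi hh)
    hcont φ₀ hstate
  exact ⟨φ, isKMSState_of_homogeneous φ hφ hinv hD fun b ⟨n, hn, hnβ⟩ =>
    ⟨n, hn, H b n _ hn hnβ⟩⟩

end CuntzPimsner

end Existence

/-! ### Bounds for the inverse temperatures -/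

section Bounds

universe u

variable {Z : Type u} [TopologicalSpace Z] [CompactSpace Z] [T2Space Z] {h : Z → Z}

/-- Square roots of a partition of unity by functions on whose supports `h` is injective. -/
theorem exists_sqrt_partitionOfUnity (hh : IsLocalHomeomorph h) :
    ∃ (m : ℕ) (u : Fin m → C(Z, ℂ)), (∀ i w, conj (u i w) = u i w) ∧
      (∀ i w w', h w = h w' → w ≠ w' → u i w * u i w' = 0) ∧ ∀ w, ∑ i, u i w * u i w = 1 := by
  choose U hU hmem hinj using hh.isLocallyInjective
  obtain ⟨t, ht⟩ := isCompact_univ.elim_finite_subcover U hU fun z _ => Set.mem_iUnion.2 ⟨z, hmem z⟩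
  obtain ⟨f, hf⟩ := PartitionOfUnity.exists_isSubordinate isClosed_univ
    (fun i : Fin t.card => U (t.equivFin.symm i)) (fun i => hU _) (fun z hz => by
      obtain ⟨w, hw, hzw⟩ := Set.mem_iUnion₂.1 (ht hz)
      exact Set.mem_iUnion.2 ⟨t.equivFin ⟨w, hw⟩, by simpa using hzw⟩)
  refine ⟨t.card, fun i => ⟨fun z => ((Real.sqrt (f i z) : ℝ) : ℂ), by fun_prop⟩,
    fun i w => Complex.conj_ofReal _, fun i w w' hw hne => ?_, fun w => ?_⟩
  · change ((Real.sqrt (f i w) : ℝ) : ℂ) * ((Real.sqrt (f i w') : ℝ) : ℂ) = 0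
    by_contra hprod
    have hsupp : ∀ v, ((Real.sqrt (f i v) : ℝ) : ℂ) ≠ 0 → v ∈ U (t.equivFin.symm i) := fun v hv =>
      hf i (subset_tsupport _ fun h0 => hv (by rw [h0]; simp))
    exact hne (hinj _ (hsupp w (left_ne_zero_of_mul hprod)) (hsupp w' (right_ne_zero_of_mul hprod)) hw)
  · change ∑ i, ((Real.sqrt (f i w) : ℝ) : ℂ) * ((Real.sqrt (f i w) : ℝ) : ℂ) = 1
    have h1 := f.sum_eq_one (Set.mem_univ w)
    rw [finsum_eq_sum_of_fintype] at h1
    rw [← Complex.ofReal_one, ← h1, Complex.ofReal_sum]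
    refine Finset.sum_congr rfl fun i _ => ?_
    rw [← Complex.ofReal_mul, Real.mul_self_sqrt (f.nonneg i w)]

namespace CuntzPimsner

theorem π_bimoduleInner (hh : IsLocalHomeomorph h) (x y : C(Z, ℂ)) :
    π hh (bimoduleInner hh x y) = star (ψ hh x) * ψ hh y :=
  ext_evalRep fun R => R.inner x y

theorem π_eq_sum (hh : IsLocalHomeomorph h) (a : C(Z, ℂ)) (n : ℕ) (x y : Fin n → C(Z, ℂ))
    (H : ∀ w, a * w = ∑ i, rankOne hh (x i) (y i) w) :
    π hh a = ∑ i, ψ hh (x i) * star (ψ hh (y i)) :=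
  ext_evalRep fun R => by
    rw [map_sum]
    exact R.covariant a n x y H

/-- The canonical map `π : C(Z) → O(X)` as a morphism of C*-algebras. -/
noncomputable def πHom (hh : IsLocalHomeomorph h) : C(Z, ℂ) →⋆ₐ[ℂ] CuntzPimsner hh where
  toFun := π hh
  map_one' := ext_evalRep fun R => map_one R.π
  map_mul' a b := ext_evalRep fun R => map_mul R.π a b
  map_zero' := ext_evalRep fun R => map_zero R.π
  map_add' a b := ext_evalRep fun R => map_add R.π a b
  commutes' c := ext_evalRep fun R => R.π.commutes' c
  map_star' a := ext_evalRep fun R => map_star R.π a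

theorem kms_ψ_mul {hh : IsLocalHomeomorph h} {β : ℝ} {φ : CuntzPimsner hh →ₗ[ℂ] ℂ}
    (hφ : IsKMSState (dynamics hh) β φ) (x : C(Z, ℂ)) (b : CuntzPimsner hh) :
    φ (b * ψ hh x) = Real.exp β * φ (ψ hh x * b) := by
  have h1 := hφ.2 (ψ hh x) b (fun z => Complex.exp (Complex.I * z) • ψ hh x)
    (by fun_prop) fun t => (dynamics_ψ hh t x).symm
  rw [h1, mul_smul_comm, map_smul, smul_eq_mul, ← mul_assoc, Complex.ofReal_exp,
    ← Complex.exp_add, ← mul_assoc, Complex.I_mul_I]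
  simp

/-- A KMS state restricts to an eigenstate of the transfer operator. -/
theorem kms_π_fiberSum {hh : IsLocalHomeomorph h} {β : ℝ} {φ : CuntzPimsner hh →ₗ[ℂ] ℂ}
    (hφ : IsKMSState (dynamics hh) β φ) (a : C(Z, ℂ)) :
    φ (πHom hh (fiberSum hh a)) = Real.exp β * φ (πHom hh a) := by
  obtain ⟨m, u, hreal, horth, hsum⟩ := exists_sqrt_partitionOfUnity hh
  -- In the sum over the fibre of `h w`, the product `u_i(w) u_i(v)` vanishes for `v ≠ w`, so only
  -- the value at `w` survives.
  have hrank : ∀ w, a * w = ∑ i, rankOne hh (a * u i) (u i) w := fun g => by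
    ext w
    rw [ContinuousMap.sum_apply]
    have h1 : ∀ i, rankOne hh (a * u i) (u i) g w = a w * g w * (u i w * u i w) := fun i => by
      change a w * u i w * bimoduleInner hh (u i) g (h w) = _
      rw [bimoduleInner_apply, transfer, Finset.mul_sum, Finset.sum_eq_single w]
      · rw [hreal]
        ring
      · intro v hv hvw
        have hv' : h w = h v := by simpa [eq_comm] using hv
        rw [hreal, mul_assoc, ← mul_assoc (u i w), horth i w v hv' (Ne.symm hvw)]
        simp
      · simp
    simp_rw [h1, ← Finset.mul_sum, hsum, mul_one]
    rfl
  have hinner : fiberSum hh a = ∑ i, bimoduleInner hh (u i) (a * u i) := by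
    ext z
    rw [ContinuousMap.sum_apply, fiberSum_apply]
    simp_rw [bimoduleInner_apply, transfer]
    rw [Finset.sum_comm]
    refine Finset.sum_congr rfl fun w _ => ?_
    have h1 : ∀ i, conj (u i w) * (a * u i) w = a w * (u i w * u i w) := fun i => by
      rw [hreal, ContinuousMap.mul_apply]
      ring
    simp_rw [h1, ← Finset.mul_sum, hsum, mul_one]
  have h2 : πHom hh a = ∑ i, ψ hh (a * u i) * star (ψ hh (u i)) := π_eq_sum hh a m _ _ hrank
  have h3 : ∀ x y, πHom hh (bimoduleInner hh x y) = star (ψ hh x) * ψ hh y := π_bimoduleInner hh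
  rw [hinner, h2, map_sum, map_sum, map_sum, Finset.mul_sum]
  refine Finset.sum_congr rfl fun i _ => ?_
  rw [h3, kms_ψ_mul hφ]

theorem IsState.π_nonneg {hh : IsLocalHomeomorph h} {φ : CuntzPimsner hh →ₗ[ℂ] ℂ}
    (hφ : IsState φ) {f : C(Z, ℂ)} (hf : ∀ z, 0 ≤ f z) : 0 ≤ φ (πHom hh f) := by
  let g : C(Z, ℂ) := ⟨fun z => ((Real.sqrt (f z).re : ℝ) : ℂ), by fun_prop⟩
  have hg : f = star g * g := by
    ext z
    change f z = conj ((Real.sqrt (f z).re : ℝ) : ℂ) * ((Real.sqrt (f z).re : ℝ) : ℂ)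
    rw [Complex.conj_ofReal, ← Complex.ofReal_mul,
      Real.mul_self_sqrt (Complex.nonneg_iff.1 (hf z)).1]
    exact Complex.ext rfl (Complex.nonneg_iff.1 (hf z)).2.symm
  rw [hg, map_mul, map_star]
  exact hφ.nonneg _

theorem fiberSum_iterate_one (hh : IsLocalHomeomorph h) (n : ℕ) (z : Z) :
    (fiberSum hh)^[n] 1 z = fiberCard h n z := by
  induction n generalizing z with
  | zero => simp [fiberCard_zero]
  | succ n ih =>
    rw [Function.iterate_succ_apply', fiberSum_apply, fiberCard_succ hh.finite_fiber]
    push_cast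
    exact Finset.sum_congr rfl fun w _ => ih w

theorem kms_π_fiberSum_iterate {hh : IsLocalHomeomorph h} {β : ℝ} {φ : CuntzPimsner hh →ₗ[ℂ] ℂ}
    (hφ : IsKMSState (dynamics hh) β φ) (n : ℕ) :
    φ (πHom hh ((fiberSum hh)^[n] 1)) = ((Real.exp (n * β) : ℝ) : ℂ) := by
  induction n with
  | zero => simpa using hφ.1.map_one
  | succ n ih =>
    rw [Function.iterate_succ_apply', kms_π_fiberSum hφ, ih, ← Complex.ofReal_mul, ← Real.exp_add]
    push_cast
    ring_nf

/-- Apply the state to the nonnegative function `L^n 1 - m`, using `φ(π(L^n 1)) = e^{nβ}`. -/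
theorem le_exp_of_le_fiberCard {hh : IsLocalHomeomorph h} {β : ℝ}
    (hβ : β ∈ inverseTemperatures hh) {n m : ℕ} (hm : ∀ z, m ≤ fiberCard h n z) :
    (m : ℝ) ≤ Real.exp (n * β) := by
  obtain ⟨φ, hφ⟩ := hβ
  have h1 := IsState.π_nonneg (f := (fiberSum hh)^[n] 1 - (m : ℂ) • 1) hφ.1 fun z => by
    rw [ContinuousMap.sub_apply, fiberSum_iterate_one, ContinuousMap.smul_apply]
    simpa using hm z
  rw [map_sub, map_sub, map_smul, map_smul, map_one, hφ.1.map_one, kms_π_fiberSum_iterate hφ,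
    smul_eq_mul, mul_one, sub_nonneg] at h1
  exact_mod_cast h1

theorem exp_le_of_fiberCard_le {hh : IsLocalHomeomorph h} {β : ℝ}
    (hβ : β ∈ inverseTemperatures hh) {n m : ℕ} (hm : ∀ z, fiberCard h n z ≤ m) :
    Real.exp (n * β) ≤ m := by
  obtain ⟨φ, hφ⟩ := hβ
  have h1 := IsState.π_nonneg (f := (m : ℂ) • 1 - (fiberSum hh)^[n] 1) hφ.1 fun z => by
    rw [ContinuousMap.sub_apply, fiberSum_iterate_one, ContinuousMap.smul_apply]
    simpa using hm z
  rw [map_sub, map_sub, map_smul, map_smul, map_one, hφ.1.map_one, kms_π_fiberSum_iterate hφ,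
    smul_eq_mul, mul_one, sub_nonneg] at h1
  exact_mod_cast h1

theorem thomsenLower_le [Nonempty Z] {hh : IsLocalHomeomorph h} (hs : Function.Surjective h)
    {β : ℝ} (hβ : β ∈ inverseTemperatures hh) : thomsenLower h ≤ β := by
  refine limsup_le_of_le (IsBoundedUnder.isCoboundedUnder_le (isBoundedUnder_of ⟨0, fun n =>
    mul_nonneg (by positivity) (Real.log_natCast_nonneg _)⟩)) ?_
  filter_upwards [eventually_gt_atTop 0] with n hn
  have hn' : (0 : ℝ) < n := by exact_mod_cast hn
  obtain ⟨z, hz⟩ : (⨅ z, fiberCard h n z) ∈ Set.range (fiberCard h n) :=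
    Nat.sInf_mem (Set.range_nonempty _)
  have hpos : 0 < ⨅ z, fiberCard h n z := hz ▸ fiberCard_pos hh.finite_fiber hs n z
  rw [inv_mul_le_iff₀ hn', Real.log_le_iff_le_exp (by exact_mod_cast hpos)]
  exact le_exp_of_le_fiberCard hβ fun z => ciInf_le' _ z

theorem le_thomsenUpper [Nonempty Z] {hh : IsLocalHomeomorph h} (hs : Function.Surjective h)
    {β : ℝ} (hβ : β ∈ inverseTemperatures hh) : β ≤ thomsenUpper h := by
  refine ge_of_tendsto (tendsto_thomsenUpper hh.finite_fiber hh.bddAbove_fiberCard_one hs) ?_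
  filter_upwards [eventually_gt_atTop 0] with n hn
  have hn' : (0 : ℝ) < n := by exact_mod_cast hn
  have hpos := iSup_fiberCard_pos hh.finite_fiber hh.bddAbove_fiberCard_one hs n
  rw [le_div_iff₀ hn', mul_comm, Real.le_log_iff_exp_le (by exact_mod_cast hpos)]
  exact exp_le_of_fiberCard_le hβ (le_iSup_fiberCard hh.finite_fiber hh.bddAbove_fiberCard_one n)

theorem thomsenUpper_mem [Nonempty Z] (hh : IsLocalHomeomorph h) (hs : Function.Surjective h) :
    thomsenUpper h ∈ inverseTemperatures hh := by
  obtain ⟨τ, h1, h2, h3, h4⟩ := exists_eigenstate hh.finite_fiber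
    (r := Real.exp (thomsenUpper h)) fun u C ε hu hε H =>
      not_exists_subEigenvector_thomsenUpper hh.finite_fiber hh.bddAbove_fiberCard_one hs hu hε H
  exact mem_inverseTemperatures_of_eigenstate hh τ h1 h2 h3 h4

theorem log_mem_of_fiberCard_eq [Nonempty Z] (hh : IsLocalHomeomorph h) {r : ℝ} (hr : 0 < r) {z : Z}
    (hz : ∀ n, (fiberCard h n z : ℝ) = r ^ n) : Real.log r ∈ inverseTemperatures hh := by
  obtain ⟨τ, h1, h2, h3, h4⟩ := exists_eigenstate hh.finite_fiber (r := r) fun u C ε hu hε H =>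
    not_exists_subEigenvector_of_fiberCard_eq hh.finite_fiber hr hz
      (fun z => (abs_le.1 (hu z)).2) hε H
  rw [← Real.exp_log hr] at h4
  exact mem_inverseTemperatures_of_eigenstate hh τ h1 h2 h3 h4

end CuntzPimsner

end Bounds

/-! ### The dumbbell graph -/

section Shift

namespace DirectedGraph

variable {V E : Type*} (G : DirectedGraph V E)

theorem exists_shift_eq (x : G.InfinitePath) {e : E} (he : G.s e = G.r (x.1 0)) :
    ∃ y : G.InfinitePath, y.1 0 = e ∧ G.shift y = x :=
  ⟨⟨fun i => Nat.casesOn i e x.1, fun i => by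
    cases i with
    | zero => exact he
    | succ i => exact x.2 i⟩, rfl, rfl⟩

theorem eq_of_zero_eq_of_shift_eq {x y : G.InfinitePath} (h0 : x.1 0 = y.1 0)
    (hs : G.shift x = G.shift y) : x = y := by
  apply Subtype.ext
  funext i
  cases i with
  | zero => exact h0
  | succ i => exact congrFun (congrArg Subtype.val hs) i

theorem fiberCard_shift_succ (hf : ∀ z, (G.shift ⁻¹' {z}).Finite) {n : ℕ} {g : V → ℕ}
    (hg : ∀ w, fiberCard G.shift n w = g (G.r (w.1 0))) (x : G.InfinitePath) (S : Finset E)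
    (hS : ∀ e, e ∈ S ↔ G.s e = G.r (x.1 0)) :
    fiberCard G.shift (n + 1) x = ∑ e ∈ S, g (G.r e) := by
  rw [fiberCard_succ hf]
  refine Finset.sum_nbij (fun w => w.1 0) (fun w hw => ?_) (fun w hw w' hw' h0 => ?_)
    (fun e he => ?_) fun w _ => hg w
  · have hw' : G.shift w = x := by simpa using hw
    rw [hS, ← hw']
    exact w.2 0
  · have h1 : G.shift w = x := by simpa using hw
    have h2 : G.shift w' = x := by simpa using hw'
    exact G.eq_of_zero_eq_of_shift_eq h0 (h1.trans h2.symm)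
  · obtain ⟨y, hy, hyx⟩ := G.exists_shift_eq x ((hS e).1 he)
    exact ⟨y, by simpa using hyx, hy⟩

end DirectedGraph

/-- The number of paths of length `n` that can be prepended to a path with a given range. -/
def dumbbellCount (n : ℕ) : DumbbellVertex → ℕ
  | .v => 2 ^ n
  | .w => 2 * 3 ^ n - 2 ^ n

theorem fiberCard_dumbbell (n : ℕ) (x : dumbbell.InfinitePath) :
    fiberCard dumbbell.shift n x = dumbbellCount n (dumbbell.r (x.1 0)) := by
  classical
  induction n generalizing x with
  | zero =>
    rw [fiberCard_zero]
    cases dumbbell.r (x.1 0) <;> rfl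
  | succ n ih =>
    have hf := dumbbell.isLocalHomeomorph_shift.finite_fiber
    cases hx : dumbbell.r (x.1 0) with
    | v =>
      rw [dumbbell.fiberCard_shift_succ hf ih x {.loopV 0, .loopV 1} fun e => by
        rw [hx]
        rcases e with i | i | _
        · fin_cases i <;> simp [dumbbell]
        · simp [dumbbell]
        · simp [dumbbell]]
      rw [Finset.sum_pair (by simp)]
      simp only [dumbbell, dumbbellCount, pow_succ]
      ring
    | w =>
      rw [dumbbell.fiberCard_shift_succ hf ih x {.bar, .loopW 0, .loopW 1, .loopW 2} fun e => by
        rw [hx]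
        rcases e with i | i | _
        · simp [dumbbell]
        · fin_cases i <;> simp [dumbbell]
        · simp [dumbbell]]
      rw [Finset.sum_insert (by simp), Finset.sum_insert (by simp), Finset.sum_pair (by simp)]
      have h23 : 2 ^ n ≤ 3 ^ n := Nat.pow_le_pow_left (by norm_num) n
      simp only [dumbbell, dumbbellCount, pow_succ]
      omega

theorem two_pow_le_dumbbellCount (n : ℕ) (a : DumbbellVertex) : 2 ^ n ≤ dumbbellCount n a := by
  have h23 : 2 ^ n ≤ 3 ^ n := Nat.pow_le_pow_left (by norm_num) n
  cases a <;> simp only [dumbbellCount] <;> omega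

theorem dumbbellCount_le (n : ℕ) (a : DumbbellVertex) :
    dumbbellCount n a ≤ 2 * 3 ^ n - 2 ^ n := by
  have h23 : 2 ^ n ≤ 3 ^ n := Nat.pow_le_pow_left (by norm_num) n
  cases a <;> simp only [dumbbellCount] <;> omega

/-- A path through one loop at `v` only. -/
def dumbbellPathV : dumbbell.InfinitePath := ⟨fun _ => .loopV 0, fun _ => rfl⟩

/-- A path through one loop at `w` only. -/
def dumbbellPathW : dumbbell.InfinitePath := ⟨fun _ => .loopW 0, fun _ => rfl⟩

instance : Nonempty dumbbell.InfinitePath := ⟨dumbbellPathV⟩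

theorem fiberCard_dumbbellPathV (n : ℕ) : fiberCard dumbbell.shift n dumbbellPathV = 2 ^ n :=
  fiberCard_dumbbell n dumbbellPathV

theorem fiberCard_dumbbellPathW (n : ℕ) :
    fiberCard dumbbell.shift n dumbbellPathW = 2 * 3 ^ n - 2 ^ n :=
  fiberCard_dumbbell n dumbbellPathW

theorem surjective_dumbbell_shift : Function.Surjective dumbbell.shift := fun x => by
  cases hx : dumbbell.r (x.1 0) with
  | v => exact (dumbbell.exists_shift_eq x (e := .loopV 0) hx.symm).imp fun _ h => h.2
  | w => exact (dumbbell.exists_shift_eq x (e := .loopW 0) hx.symm).imp fun _ h => h.2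

theorem isLeast_fiberCard_dumbbell (n : ℕ) :
    IsLeast (Set.range (fiberCard dumbbell.shift n)) (2 ^ n) := by
  refine ⟨⟨dumbbellPathV, fiberCard_dumbbellPathV n⟩, ?_⟩
  rintro _ ⟨x, rfl⟩
  rw [fiberCard_dumbbell]
  exact two_pow_le_dumbbellCount n _

theorem isGreatest_fiberCard_dumbbell (n : ℕ) :
    IsGreatest (Set.range (fiberCard dumbbell.shift n)) (2 * 3 ^ n - 2 ^ n) := by
  refine ⟨⟨dumbbellPathW, fiberCard_dumbbellPathW n⟩, ?_⟩
  rintro _ ⟨x, rfl⟩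
  rw [fiberCard_dumbbell]
  exact dumbbellCount_le n _

theorem thomsenLower_dumbbell : thomsenLower dumbbell.shift = Real.log 2 := by
  refine Tendsto.limsup_eq (tendsto_const_nhds.congr' ?_)
  filter_upwards [eventually_gt_atTop 0] with n hn
  have hn' : (n : ℝ) ≠ 0 := by exact_mod_cast hn.ne'
  rw [show (⨅ z, fiberCard dumbbell.shift n z) = 2 ^ n from
    (isLeast_fiberCard_dumbbell n).csInf_eq]
  push_cast
  rw [Real.log_pow, inv_mul_cancel_left₀ hn']

theorem thomsenUpper_dumbbell : thomsenUpper dumbbell.shift = Real.log 3 := by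
  refine Tendsto.limsup_eq ?_
  have hup : Tendsto (fun n : ℕ => Real.log 3 + Real.log 2 / n) atTop (𝓝 (Real.log 3 + 0)) :=
    tendsto_const_nhds.add (tendsto_const_div_atTop_nhds_zero_nat _)
  rw [add_zero] at hup
  have hsup : ∀ n, (⨆ z, fiberCard dumbbell.shift n z) = 2 * 3 ^ n - 2 ^ n := fun n =>
    (isGreatest_fiberCard_dumbbell n).csSup_eq
  have h23 : ∀ n, 2 ^ n ≤ 3 ^ n := fun n => Nat.pow_le_pow_left (by norm_num) n
  refine tendsto_of_tendsto_of_tendsto_of_le_of_le' tendsto_const_nhds hup ?_ ?_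
  · filter_upwards [eventually_gt_atTop 0] with n hn
    have hn' : (0 : ℝ) < n := by exact_mod_cast hn
    rw [hsup, le_inv_mul_iff₀ hn', ← Real.log_pow]
    have h1 : 3 ^ n ≤ 2 * 3 ^ n - 2 ^ n := by have := h23 n; omega
    exact Real.log_le_log (by positivity) (by exact_mod_cast h1)
  · filter_upwards [eventually_gt_atTop 0] with n hn
    have hn' : (0 : ℝ) < n := by exact_mod_cast hn
    rw [hsup, inv_mul_le_iff₀ hn', mul_add, mul_div_cancel₀ _ hn'.ne', ← Real.log_pow,
      ← Real.log_mul (by positivity) (by positivity)]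
    have h1 : 0 < 2 * 3 ^ n - 2 ^ n := by
      have := h23 n
      have : 0 < 3 ^ n := by positivity
      omega
    have h2 : 2 * 3 ^ n - 2 ^ n ≤ 3 ^ n * 2 := (Nat.sub_le _ _).trans_eq (mul_comm _ _)
    exact Real.log_le_log (by exact_mod_cast h1) (by exact_mod_cast h2)

end Shift

theorem mainTheorem4 :
    (∀ (Z : Type*) [TopologicalSpace Z] [CompactSpace Z] [T2Space Z] [Nonempty Z]
      (h : Z → Z) (hh : IsLocalHomeomorph h), Function.Surjective h →
      (∀ β ∈ CuntzPimsner.inverseTemperatures hh, thomsenLower h ≤ β ∧ β ≤ thomsenUpper h) ∧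
      thomsenUpper h ∈ CuntzPimsner.inverseTemperatures hh) ∧
    (∀ n : ℕ, IsLeast (Set.range (fiberCard dumbbell.shift n)) (2 ^ n)) ∧
    thomsenLower dumbbell.shift = Real.log 2 ∧
    thomsenUpper dumbbell.shift = Real.log 3 ∧
    IsLeast (CuntzPimsner.inverseTemperatures dumbbell.isLocalHomeomorph_shift) (Real.log 2) ∧
    IsGreatest (CuntzPimsner.inverseTemperatures dumbbell.isLocalHomeomorph_shift) (Real.log 3) := by
  have hs := surjective_dumbbell_shift
  refine ⟨fun Z _ _ _ _ h hh hsurj => ⟨fun β hβ => ⟨CuntzPimsner.thomsenLower_le hsurj hβ,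
    CuntzPimsner.le_thomsenUpper hsurj hβ⟩, CuntzPimsner.thomsenUpper_mem hh hsurj⟩,
    isLeast_fiberCard_dumbbell, thomsenLower_dumbbell, thomsenUpper_dumbbell, ⟨?_, fun β hβ => ?_⟩,
    ⟨?_, fun β hβ => ?_⟩⟩
  · exact CuntzPimsner.log_mem_of_fiberCard_eq dumbbell.isLocalHomeomorph_shift two_pos
      (z := dumbbellPathV) fun n => by
        rw [fiberCard_dumbbellPathV]
        push_cast
        rfl
  · exact thomsenLower_dumbbell ▸ CuntzPimsner.thomsenLower_le hs hβ
  · exact thomsenUpper_dumbbell ▸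
      CuntzPimsner.thomsenUpper_mem dumbbell.isLocalHomeomorph_shift hs
  · exact thomsenUpper_dumbbell ▸ CuntzPimsner.le_thomsenUpper hs hβ
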